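/- Conventions. $\mathcal X,\mathcal Y,\hat{\mathcal X}$ are finite alphabets ($\hat{\mathcal X}$ non-empty), $\mathcal P(\mathcal A)$ is the set of probability distributions on a finite set $\mathcal A$, logarithms and information quantities are in base $2$, $[x]^+=\max(0,x)$, and $D$, $I$, $H$ denote divergence (with $D(Q\|P)=\infty$ if $Q\not\ll P$), mutual information and (conditional) entropy. Exponent. Let $P_{XY}\in\mathcal P(\mathcal X\times\mathcal Y)$, $d:\mathcal X\times\hat{\mathcal X}\to\mathbb R$, and let $(X_i,Y_i)$ be i.i.d. with law $P_{XY}$. For an encoder $f:\mathcal X^n\to\mathcal M$ ($\mathcal M$ finite) and a decoder $g:\mathcal M\times\mathcal Y^n\to\hat{\mathcal X}^n$ put $\hat X^n=g(f(X^n),Y^n)$ and $P_e(f,g,\Delta,d)=\Pr\big(\tfrac1n\sum_{i=1}^n d(X_i,\hat X_i)>\Delta\big)$. Define $$\pi(R,\Delta,P_{XY},d)=\lim_{\epsilon\downarrow0}\ \liminf_{n\to\infty}\ -\frac1n\log\Big[\min_{(f,g):\ \log|\mathcal M|\le n(R+\epsilon)}P_e(f,g,\Delta,d)\Big]\in[0,\infty].$$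 Graph functional. For a simple graph $G$ on a finite vertex set $\mathcal A$ and $Q\in\mathcal P(\mathcal A)$ let $\kappa(G,Q)=\max_V H(V|Q)$, the maximum being over stochastic matrices $V$ on $\mathcal A$ with $QV=Q$ and with $V(b|a)=0$ whenever $a\ne b$ and $a,b$ are not adjacent in $G$. For a distribution $Q_X$ on $\mathcal X$ and a channel $Q_{U|X}$ from $\mathcal X$ to a finite alphabet $\mathcal U$ let $G_U$ be the graph on $\mathcal U$ in which $u\neq u'$ are adjacent iff there is $y\in\mathcal Y$ with $Q_{UY}(u,y)>0$ and $Q_{UY}(u',y)>0$, where $Q_{UY}(u,y)=\sum_xP_{XY}(x,y)Q_{U|X}(u|x)$; and put $\kappa_2=[\kappa(G_U,Q_U)-H(Q_{U|X}|Q_X)]^+$ with $Q_U(u)=\sum_xQ_X(x)Q_{U|X}(u|x)$. Theorem. Let $R>0$ and $\Delta>0$. Then $$\pi(R,\Delta,P_{XY},d)\ \ge\ \inf_{Q_X}\ \sup_{Q_{U|X}}\ \inf_{Q_Y}\ \sup_{\phi}\ \inf_{Q_{XYU}}\ \eta,$$ where $Q_X\in\mathcal P(\mathcal X)$; $Q_{U|X}$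 ranges over the channels from $\mathcal X$ to an arbitrary finite alphabet $\mathcal U$; $Q_Y\in\mathcal P(\mathcal Y)$; $\phi$ ranges over the maps $\mathcal Y\times\mathcal U\to\hat{\mathcal X}$; $Q_{XYU}$ ranges over the distributions on $\mathcal X\times\mathcal Y\times\mathcal U$ with $Q_{XU}=Q_XQ_{U|X}$ and $Y$-marginal $Q_Y$; and $$\eta=\begin{cases}D(Q_{XYU}\|P_{XY}Q_{U|X})&\text{if }\mathbb E_Q[d(X,\phi(Y,U))]\ge\Delta,\\ D(Q_{XYU}\|P_{XY}Q_{U|X})+[R-I_Q(X;U)+I_Q(Y;U)]^+&\text{if }\mathbb E_Q[d(X,\phi(Y,U))]<\Delta\text{ and }\kappa_2\ge R,\\ \infty&\text{otherwise.}\end{cases}$$ Moreover, let $\eta_D$ be obtained from $\eta$ by replacing the condition $\kappa_2\ge R$ with $I_Q(X;U)\ge R$. Then $\eta_D\le\eta$ for all $Q_X$, $Q_{U|X}$, $\phi$, $Q_Y$ and $Q_{XYU}$ as above, and consequently the bound above is never smaller than the same expression with $\eta_D$ in place of $\eta$ (the authors' earlier exponent). -/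

import Mathlib

open scoped Topology ENNReal

namespace WynerZiv

noncomputable section

/-! ### Information measures on finite alphabets (base two)

A distribution on a finite alphabet `A` is an element of `stdSimplex ℝ A`.  A channel from `A` to
`B` is a function `V : A → B → ℝ`, with `V a b` the probability of `b` given `a`. -/

/-- `V` is a channel (stochastic matrix): each row is a probability distribution. -/
def IsChannel {A B : Type*} [Fintype B] (V : A → B → ℝ) : Prop :=
  ∀ a, V a ∈ stdSimplex ℝ B

/-- The conditional entropy `H(V | Q) = ∑ₐ Q(a) H(V(· | a))`, in bits. -/
def condEntropy {A B : Type*} [Fintype A] [Fintype B] (Q : A → ℝ) (V : A → B → ℝ) : ℝ :=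
  ∑ a, Q a * ∑ b, -(V a b * Real.logb 2 (V a b))

/-- The mutual information, in bits, of a pair with joint distribution `J`. -/
def mutualInfo {A B : Type*} [Fintype A] [Fintype B] (J : A × B → ℝ) : ℝ :=
  ∑ a, ∑ b, J (a, b) * Real.logb 2 (J (a, b) / ((∑ b', J (a, b')) * ∑ a', J (a', b)))

open Classical in
/-- The divergence `D(Q ‖ P)` in bits; it is infinite if `Q` is not dominated by `P`. -/
def divergence {A : Type*} [Fintype A] (Q P : A → ℝ) : EReal :=
  if ∀ a, P a = 0 → Q a = 0 then ((∑ a, Q a * Real.logb 2 (Q a / P a) : ℝ) : EReal) else ⊤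

/-! ### The graph functional -/

/-- The characteristic graph of a joint distribution `J` on `A × B`: distinct letters `a`, `a'` are
adjacent iff some `b` has positive probability together with both. -/
def charGraph {A B : Type*} (J : A × B → ℝ) : SimpleGraph A where
  Adj a a' := a ≠ a' ∧ ∃ b, 0 < J (a, b) ∧ 0 < J (a', b)
  symm := ⟨fun _ _ h => ⟨h.1.symm, h.2.imp fun _ hb => ⟨hb.2, hb.1⟩⟩⟩
  loopless := ⟨fun _ h => h.1 rfl⟩

/-- The channels over which `κ(G, Q)` maximizes: `V ≪ A + I` with `A` the adjacency matrix of `G`,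
and `Q V = Q`. -/
def kappaChannels {A : Type*} [Fintype A] (G : SimpleGraph A) (Q : A → ℝ) : Set (A → A → ℝ) :=
  {V | IsChannel V ∧ (∀ a b, ¬(a = b ∨ G.Adj a b) → V a b = 0) ∧ ∀ b, ∑ a, Q a * V a b = Q b}

/-- `κ(G, Q)`, the maximum of `H(V | Q)` over the channels `V ≪ G` with `Q V = Q`. -/
def kappa {A : Type*} [Fintype A] (G : SimpleGraph A) (Q : A → ℝ) : ℝ :=
  sSup (condEntropy Q '' kappaChannels G Q)

/-- The maximum in the definition of `κ` is attained. -/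
theorem kappa_isGreatest {A : Type*} [Fintype A] (G : SimpleGraph A) (Q : A → ℝ) :
    IsGreatest (condEntropy Q '' kappaChannels G Q) (kappa G Q) := by
  classical
  have hcont : Continuous (condEntropy Q : (A → A → ℝ) → ℝ) := by
    have h : (condEntropy Q : (A → A → ℝ) → ℝ) =
        fun V => ∑ a, Q a * ∑ b, Real.negMulLog (V a b) / Real.log 2 := by
      funext V
      simp only [condEntropy, Real.negMulLog, Real.logb]
      refine Finset.sum_congr rfl fun a _ => ?_
      congr 1
      refine Finset.sum_congr rfl fun b _ => ?_
      ring
    rw [h]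
    have := Real.continuous_negMulLog
    fun_prop
  have hcomp : IsCompact (kappaChannels G Q) := by
    have hK : IsCompact (Set.univ.pi fun _ : A => stdSimplex ℝ A) :=
      isCompact_univ_pi fun _ => isCompact_stdSimplex ℝ A
    have hC : IsClosed {V : A → A → ℝ | (∀ a b, ¬(a = b ∨ G.Adj a b) → V a b = 0) ∧
        ∀ b, ∑ a, Q a * V a b = Q b} := by
      simp only [Set.ofPred_and, Set.ofPred_forall]
      refine IsClosed.inter ?_ ?_
      · exact isClosed_iInter fun a => isClosed_iInter fun b => isClosed_iInter fun _ =>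
          isClosed_eq (by fun_prop) continuous_const
      · exact isClosed_iInter fun b => isClosed_eq (by fun_prop) continuous_const
    convert hK.inter_right hC using 1
    ext V
    simp [kappaChannels, IsChannel]
  have hne : (kappaChannels G Q).Nonempty := by
    refine ⟨fun a => Pi.single a 1, fun a => single_mem_stdSimplex ℝ a, ?_, ?_⟩
    · intro a b h
      exact Pi.single_eq_of_ne (fun hab => h (Or.inl hab.symm)) _
    · intro b
      simp [Pi.single_apply]
  exact (hcomp.image hcont).isGreatest_sSup (hne.image _)

/-- The joint distribution `Q_{UY}(u, y) = ∑ₓ P(x, y) W(u | x)`. -/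
def inducedUY {X Y U : Type*} [Fintype X] (P : X × Y → ℝ) (W : X → U → ℝ) : U × Y → ℝ :=
  fun p => ∑ x, P (x, p.2) * W x p.1

/-- `κ₂ = [κ(G_U, Q_U) - H(W | Q_X)]⁺`, where `Q_U = Q_X W` and `G_U` is the characteristic graph of
the joint distribution induced by `P` and `W`. -/
def kappa₂ {X Y U : Type*} [Fintype X] [Fintype U] (P : X × Y → ℝ) (QX : X → ℝ)
    (W : X → U → ℝ) : ℝ :=
  max 0 (kappa (charGraph (inducedUY P W)) (fun u => ∑ x, QX x * W x u) - condEntropy QX W)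

/-! ### The Wyner–Ziv error exponent -/

section Exponent

variable {X Y Z : Type*} [Fintype X] [Fintype Y]

open Classical in
/-- The probability under `Pⁿ` that the block distortion `(1/n) ∑ᵢ d(Xᵢ, X̂ᵢ)` exceeds `Δ`, where
`X̂ⁿ = g(f(Xⁿ), Yⁿ)`. -/
def errorProb (P : X × Y → ℝ) (d : X → Z → ℝ) (Δ : ℝ) {n : ℕ} {M : Type*}
    (f : (Fin n → X) → M) (g : M → (Fin n → Y) → Fin n → Z) : ℝ :=
  ∑ x : Fin n → X, ∑ y : Fin n → Y,
    if Δ < (∑ i, d (x i) (g (f x) y i)) / n then ∏ i, P (x i, y i) else 0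

/-- The least error probability of an encoder/decoder pair of block length `n` whose message set `M`
satisfies `log |M| ≤ n r`. -/
def minErrorProb (P : X × Y → ℝ) (d : X → Z → ℝ) (Δ r : ℝ) (n : ℕ) : ℝ≥0∞ :=
  ⨅ (k : ℕ) (_ : Real.logb 2 k ≤ n * r) (f : (Fin n → X) → Fin k)
    (g : Fin k → (Fin n → Y) → Fin n → Z), ENNReal.ofReal (errorProb P d Δ f g)

/-- `liminf_{n → ∞} -(1/n) log₂ (min P_e)` under the rate constraint `log |M| ≤ n r`; a vanishing
error probability contributes `⊤`. -/
def exponentAtRate (P : X × Y → ℝ) (d : X → Z → ℝ) (Δ r : ℝ) : EReal :=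
  Filter.liminf (fun n : ℕ =>
    -ENNReal.log (minErrorProb P d Δ r n) / ((n * Real.log 2 : ℝ) : EReal)) Filter.atTop

/-- The Wyner–Ziv error exponent `π(R, Δ, P, d)`, the limit as `ε ↓ 0` of the exponent under the
rate constraint `log |M| ≤ n (R + ε)`. -/
def errorExponent (R Δ : ℝ) (P : X × Y → ℝ) (d : X → Z → ℝ) : EReal :=
  Filter.limUnder (𝓝[>] (0 : ℝ)) fun ε => exponentAtRate P d Δ (R + ε)

theorem exponentAtRate_mono (P : X × Y → ℝ) (d : X → Z → ℝ) (Δ : ℝ) :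
    Monotone (exponentAtRate P d Δ) := by
  intro r s hrs
  refine Filter.liminf_le_liminf (Filter.Eventually.of_forall fun n => ?_)
  refine EReal.div_le_div_right_of_nonneg ?_ (EReal.neg_le_neg_iff.2 ?_)
  · exact_mod_cast mul_nonneg n.cast_nonneg (Real.log_nonneg one_le_two)
  · refine ENNReal.log_monotone (iInf_mono fun k => le_iInf fun hk => iInf_le_of_le ?_ le_rfl)
    exact hk.trans (mul_le_mul_of_nonneg_left hrs n.cast_nonneg)

/-- The limit in the definition of the exponent exists. -/
theorem tendsto_errorExponent (R Δ : ℝ) (P : X × Y → ℝ) (d : X → Z → ℝ) :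
    Filter.Tendsto (fun ε => exponentAtRate P d Δ (R + ε)) (𝓝[>] (0 : ℝ))
      (𝓝 (errorExponent R Δ P d)) := by
  have h : Monotone fun ε => exponentAtRate P d Δ (R + ε) := fun a b hab =>
    exponentAtRate_mono P d Δ (by linarith)
  exact tendsto_nhds_limUnder ⟨_, h.tendsto_nhdsGT 0⟩

end Exponent

/-! ### The single-letter bounds -/

section Bound

variable {X Y Z : Type*} [Fintype X] [Fintype Y]

/-- The three-case objective common to both bounds; `t` is the quantity whose comparison with `R`
separates the second case from the third, and `φ` is the reproduction function. -/
def objective (t : ℝ) (R Δ : ℝ) (P : X × Y → ℝ) (d : X → Z → ℝ) {m : ℕ} (W : X → Fin m → ℝ)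
    (φ : Y → Fin m → Z) (Q : X × Y × Fin m → ℝ) : EReal :=
  let D := divergence Q fun q => P (q.1, q.2.1) * W q.1 q.2.2
  let I_XU := mutualInfo fun p : X × Fin m => ∑ y, Q (p.1, y, p.2)
  let I_YU := mutualInfo fun p : Y × Fin m => ∑ x, Q (x, p.1, p.2)
  open Classical in
  if Δ ≤ ∑ q, Q q * d q.1 (φ q.2.1 q.2.2) then D
  else if R ≤ t then D + ((max 0 (R - I_XU + I_YU) : ℝ) : EReal)
  else ⊤

/-- `η(R, P, Q, φ)`; here `W` is the test channel `Q_{U|X}`, whose rows at letters `x` with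
`Q_X(x) = 0` are not determined by `Q`. -/
def eta (R Δ : ℝ) (P : X × Y → ℝ) (d : X → Z → ℝ) {m : ℕ} (W : X → Fin m → ℝ)
    (φ : Y → Fin m → Z) (Q : X × Y × Fin m → ℝ) : EReal :=
  objective (kappa₂ P (fun x => ∑ y, ∑ u, Q (x, y, u)) W) R Δ P d W φ Q

/-- The objective of the earlier exponent, with `I_Q(X; U)` in place of `κ₂`. -/
def etaD (R Δ : ℝ) (P : X × Y → ℝ) (d : X → Z → ℝ) {m : ℕ} (W : X → Fin m → ℝ)
    (φ : Y → Fin m → Z) (Q : X × Y × Fin m → ℝ) : EReal :=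
  objective (mutualInfo fun p : X × Fin m => ∑ y, Q (p.1, y, p.2)) R Δ P d W φ Q

/-- The joint distributions of `(X, Y, U)` with `Q_{XU} = Q_X W` and with `Y`-marginal `Q_Y`. -/
def couplings {m : ℕ} (QX : X → ℝ) (W : X → Fin m → ℝ) (QY : Y → ℝ) :
    Set (X × Y × Fin m → ℝ) :=
  {Q | Q ∈ stdSimplex ℝ (X × Y × Fin m) ∧ (∀ x u, ∑ y, Q (x, y, u) = QX x * W x u) ∧
    ∀ y, ∑ x, ∑ u, Q (x, y, u) = QY y}

/-- `inf_{Q_X} sup_{Q_{U|X}} inf_{Q_Y} sup_φ inf_{Q_{XYU}} F`, where the supremum over test channels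
runs over all finite auxiliary alphabets. -/
def infSup (F : ∀ {m : ℕ}, (X → Fin m → ℝ) → (Y → Fin m → Z) → (X × Y × Fin m → ℝ) → EReal) :
    EReal :=
  ⨅ QX ∈ stdSimplex ℝ X, ⨆ (m : ℕ) (W : X → Fin m → ℝ) (_ : IsChannel W),
    ⨅ QY ∈ stdSimplex ℝ Y, ⨆ φ : Y → Fin m → Z, ⨅ Q ∈ couplings QX W QY, F W φ Q

end Bound

end

end WynerZiv

/-! The achievability proof is a random-coding argument by the method of types. Words with the same
joint type have the same probability, there are only polynomially many types, and type classes are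
counted by entropies. So everything reduces to comparing single-letter exponents, up to a slack `δ`
per letter.

Fix a source type `Q_X` and a near-optimal test channel `W`. About `2 ^ (n I(X;U))` codewords, drawn
letterwise from a law close to `Q_U`, contain an admissible description of every source word with
type near `Q_X` (`exists_nhds_admissible`). The probability of missing a word is doubly
exponentially small. For any choice of description, the joint type with source and side information
equals `Q` with probability at most `2 ^ (-n D)` (`sum_type_le`). Given the description, the decoder
picks `φ` according to the type of `yⁿ`.

If `κ₂ ≥ R`, the codewords are thrown into `2 ^ (n R)` random bins, and the decoder takes the word
of least joint entropy with `yⁿ` in the bin (`exists_binning_code`). A union bound over pairs of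
codewords gives `2 ^ (n (2I - R - D - I_XU - I_YU))`. Since `I` is close to `I_XU`, the exponent is
`D + R - I_XU + I_YU`. The positive part arises because joint types of large divergence are
discarded beforehand.

If `κ₂ < R`, two codewords can be compatible with the same `yⁿ` only when they are letterwise equal
or adjacent in `G_U`. A word has about `2 ^ (n κ)` such neighbours of the right type, of which about
`2 ^ (n (I + κ - H(U))) = 2 ^ (n (κ - H(U|X)))` land in the codebook, fewer than `2 ^ (n R)` up to
slack. A greedy colouring therefore fits into the rate, and colour and side information determine
the codeword with certainty (`exists_zeroError_code`). Only excess distortion under correct decoding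
remains, with exponent `D`.

Types only approximate the single-letter constraints. Compactness supplies the uniformity: over
`Q_Y` in `exists_nhds_reproduction`, for `κ` in `exists_nhds_kappa`, and over `Q_X` in
`eventually_minErrorProb_le`, where finitely many local codes are glued. The comparison with the
earlier bound is `κ₂ ≤ I(X;U)`, because `κ(G, Q) ≤ H(Q)`. -/

namespace WynerZiv

noncomputable section

/-! ### Pushforwards, entropy and empirical distributions -/

section Basics

open scoped Classical

set_option linter.unusedSectionVars false

variable {A B C : Type*} [Fintype A] [Fintype B] [Fintype C]

/-- The pushforward of a weight function along `g`. -/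
def push (g : A → B) (Q : A → ℝ) (b : B) : ℝ := ∑ a, if g a = b then Q a else 0

/-- The entropy of a weight function, in bits. -/
def ent (Q : A → ℝ) : ℝ := ∑ a, -(Q a * Real.logb 2 (Q a))

/-- The empirical distribution of a word. -/
def emp {n : ℕ} (z : Fin n → A) (a : A) : ℝ := (∑ i, if z i = a then (1 : ℝ) else 0) / n

theorem sum_push_mul (g : A → B) (Q : A → ℝ) (f : B → ℝ) :
    ∑ b, push g Q b * f b = ∑ a, Q a * f (g a) := by
  simp only [push, Finset.sum_mul]
  rw [Finset.sum_comm]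
  refine Finset.sum_congr rfl fun a _ => ?_
  simp [ite_mul]

theorem push_apply_eq (g : A → B) (Q : A → ℝ) (b : B) :
    push g Q b = ∑ a, Q a * if g a = b then 1 else 0 := by
  simp [push]

theorem push_push (h : B → C) (g : A → B) (Q : A → ℝ) :
    push h (push g Q) = push (h ∘ g) Q := by
  funext c
  rw [push_apply_eq, sum_push_mul, push_apply_eq]
  rfl

theorem sum_push (g : A → B) (Q : A → ℝ) : ∑ b, push g Q b = ∑ a, Q a := by
  simpa using sum_push_mul g Q fun _ => 1

theorem push_nonneg {g : A → B} {Q : A → ℝ} (hQ : ∀ a, 0 ≤ Q a) (b : B) : 0 ≤ push g Q b :=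
  Finset.sum_nonneg fun a _ => by split_ifs <;> simp [hQ]

theorem le_push {g : A → B} {Q : A → ℝ} (hQ : ∀ a, 0 ≤ Q a) (a : A) : Q a ≤ push g Q (g a) := by
  refine le_of_eq_of_le ?_ (Finset.single_le_sum (f := fun a' => if g a' = g a then Q a' else 0)
    (fun a' _ => by split_ifs <;> simp [hQ]) (Finset.mem_univ a))
  simp

theorem push_mem_stdSimplex {Q : A → ℝ} (hQ : Q ∈ stdSimplex ℝ A) (g : A → B) :
    push g Q ∈ stdSimplex ℝ B :=
  ⟨push_nonneg hQ.1, (sum_push g Q).trans hQ.2⟩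

@[fun_prop]
theorem continuous_push (g : A → B) : Continuous (push g) := by
  refine continuous_pi fun b => ?_
  have : (fun Q => push g Q b) = fun Q : A → ℝ => ∑ a, Q a * if g a = b then 1 else 0 :=
    funext fun Q => push_apply_eq g Q b
  rw [this]
  fun_prop

theorem ent_eq_negMulLog (Q : A → ℝ) : ent Q = ∑ a, Real.negMulLog (Q a) / Real.log 2 := by
  simp only [ent, Real.negMulLog, Real.logb]
  exact Finset.sum_congr rfl fun a _ => by ring

@[fun_prop]
theorem continuous_ent : Continuous (ent : (A → ℝ) → ℝ) := by
  have h : (ent : (A → ℝ) → ℝ) = fun Q => ∑ a, Real.negMulLog (Q a) / Real.log 2 :=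
    funext ent_eq_negMulLog
  rw [h]
  have := Real.continuous_negMulLog
  fun_prop

theorem sum_mul_logb_push (g : A → B) (Q : A → ℝ) :
    ∑ a, Q a * Real.logb 2 (push g Q (g a)) = -ent (push g Q) := by
  rw [← sum_push_mul g Q fun b => Real.logb 2 (push g Q b)]
  simp [ent]

theorem sum_mul_logb_self (Q : A → ℝ) : ∑ a, Q a * Real.logb 2 (Q a) = -ent Q := by
  simp [ent]

theorem push_emp {n : ℕ} (g : A → B) (z : Fin n → A) : push g (emp z) = emp (g ∘ z) := by
  funext b
  simp only [push_apply_eq, emp, Finset.sum_div, Finset.sum_mul]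
  rw [Finset.sum_comm]
  refine Finset.sum_congr rfl fun i _ => ?_
  rw [Finset.sum_eq_single (z i)]
  · simp [div_eq_inv_mul]
  · intro a _ h
    simp [h.symm]
  · simp

theorem sum_emp_mul {n : ℕ} (hn : 0 < n) (z : Fin n → A) (f : A → ℝ) :
    n * ∑ a, emp z a * f a = ∑ i, f (z i) := by
  have hn' : (n : ℝ) ≠ 0 := by positivity
  simp only [emp, Finset.mul_sum, Finset.sum_div, Finset.sum_mul]
  rw [Finset.sum_comm]
  refine Finset.sum_congr rfl fun i _ => ?_
  rw [Finset.sum_eq_single (z i)]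
  · simp [hn']
  · intro a _ h
    simp [h.symm]
  · simp

theorem emp_nonneg {n : ℕ} (z : Fin n → A) (a : A) : 0 ≤ emp z a :=
  div_nonneg (Finset.sum_nonneg fun i _ => by split_ifs <;> simp) n.cast_nonneg

theorem emp_mem_stdSimplex {n : ℕ} (hn : 0 < n) (z : Fin n → A) : emp z ∈ stdSimplex ℝ A := by
  refine ⟨emp_nonneg z, ?_⟩
  have h := sum_emp_mul hn z fun _ => 1
  have hn' : (n : ℝ) ≠ 0 := by positivity
  simp only [mul_one, Finset.sum_const, Finset.card_univ, Fintype.card_fin, nsmul_eq_mul] at h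
  exact mul_left_cancel₀ hn' (by rw [h, mul_one])

theorem emp_apply_pos {n : ℕ} (z : Fin n → A) (i : Fin n) : 0 < emp z (z i) := by
  refine div_pos ?_ (by exact_mod_cast i.pos)
  refine Finset.sum_pos' (fun j _ => by split_ifs <;> simp) ⟨i, Finset.mem_univ i, by simp⟩

theorem exists_of_emp_ne_zero {n : ℕ} {z : Fin n → A} {a : A} (h : emp z a ≠ 0) :
    ∃ i, z i = a := by
  by_contra! hne
  exact h (by simp [emp, hne])

/-- A product over the letters of a word depends only on the type of the word. Positivity is
required only at letters that occur. -/
theorem prod_eq_rpow {n : ℕ} (hn : 0 < n) (z : Fin n → A) {w : A → ℝ}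
    (hw : ∀ i, 0 < w (z i)) :
    ∏ i, w (z i) = (2 : ℝ) ^ (n * ∑ a, emp z a * Real.logb 2 (w a)) := by
  rw [sum_emp_mul hn, Real.rpow_sum_of_pos two_pos]
  exact Finset.prod_congr rfl fun i _ => (Real.rpow_logb two_pos (by norm_num) (hw i)).symm

/-- The empirical distributions of words of length `n`. -/
def types (A : Type*) [Fintype A] (n : ℕ) : Finset (A → ℝ) :=
  Finset.univ.image (emp : (Fin n → A) → A → ℝ)

theorem emp_mem_types {n : ℕ} (z : Fin n → A) : emp z ∈ types A n :=
  Finset.mem_image_of_mem _ (Finset.mem_univ z)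

/-- A type is determined by its letter counts, each between `0` and `n`. -/
theorem card_types_le (n : ℕ) : (types A n).card ≤ (n + 1) ^ Fintype.card A := by
  have hsub : types A n ⊆ Finset.univ.image fun (k : A → Fin (n + 1)) a => ((k a : ℕ) : ℝ) / n := by
    intro Q hQ
    obtain ⟨z, -, rfl⟩ := Finset.mem_image.1 hQ
    refine Finset.mem_image.2 ⟨fun a => ⟨(Finset.univ.filter fun i => z i = a).card, ?_⟩,
      Finset.mem_univ _, ?_⟩
    · exact Nat.lt_succ_of_le ((Finset.card_filter_le _ _).trans (by simp))
    · funext a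
      simp [emp]
  refine (Finset.card_le_card hsub).trans (Finset.card_image_le.trans ?_)
  simp

/-! ### Sums of products -/

theorem sum_prod_eq {ι α : Type*} [Fintype ι] [DecidableEq ι] [Fintype α] (f : ι → α → ℝ) :
    ∑ u : ι → α, ∏ i, f i (u i) = ∏ i, ∑ a, f i a := by
  rw [Finset.prod_univ_sum]
  simp

/-- At most `2 ^ (n H(A | B))` words have joint empirical distribution `N` with a given word. -/
theorem card_cond_type_le {n : ℕ} (hn : 0 < n) (s : Fin n → B) (N : A × B → ℝ) :
    ((Finset.univ.filter fun t : Fin n → A => emp (fun i => (t i, s i)) = N).card : ℝ) ≤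
      2 ^ (n * (ent N - ent (push Prod.snd N))) := by
  set S := Finset.univ.filter fun t : Fin n → A => emp (fun i => (t i, s i)) = N with hS
  by_cases hne : S.Nonempty
  swap
  · rw [Finset.not_nonempty_iff_eq_empty.1 hne]
    simp only [Finset.card_empty, Nat.cast_zero]
    positivity
  obtain ⟨t₀, ht₀⟩ := hne
  have hN0 : ∀ p, 0 ≤ N p := by
    rw [← (Finset.mem_filter.1 ht₀).2]
    exact emp_nonneg _
  have hb0 : ∀ b, 0 ≤ push Prod.snd N b := push_nonneg hN0
  -- The conditional law under `N`. Its product weights sum to at most one over all words `t`, while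
  -- each counted word has weight `2 ^ (-n H(A | B))`; this bounds their number.
  set w : A × B → ℝ := fun p => N p / push Prod.snd N p.2 with hw
  have hw0 : ∀ p, 0 ≤ w p := fun p => div_nonneg (hN0 p) (hb0 _)
  have key : ∀ t ∈ S, ∏ i, w (t i, s i) = (2 : ℝ) ^ (-(n * (ent N - ent (push Prod.snd N)))) := by
    intro t ht
    have hE := (Finset.mem_filter.1 ht).2
    have hpos : ∀ i, 0 < N (t i, s i) := fun i => by
      rw [← hE]; exact emp_apply_pos (fun i => (t i, s i)) i
    have hpos' : ∀ i, 0 < push Prod.snd N (s i) := fun i =>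
      (hpos i).trans_le (le_push hN0 (t i, s i))
    rw [prod_eq_rpow hn (fun i => (t i, s i)) (w := w) fun i => div_pos (hpos i) (hpos' i), hE]
    congr 1
    have : ∀ p, N p * Real.logb 2 (w p) =
        N p * Real.logb 2 (N p) - N p * Real.logb 2 (push Prod.snd N p.2) := by
      intro p
      by_cases hp : N p = 0
      · simp [hp]
      · have h1 : 0 < N p := lt_of_le_of_ne (hN0 p) (Ne.symm hp)
        rw [hw, Real.logb_div hp (h1.trans_le (le_push hN0 p)).ne']
        ring
    rw [Finset.sum_congr rfl fun p _ => this p, Finset.sum_sub_distrib, sum_mul_logb_self,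
      sum_mul_logb_push]
    ring
  have hsum : ∑ t : Fin n → A, ∏ i, w (t i, s i) ≤ 1 := by
    rw [sum_prod_eq fun i a => w (a, s i)]
    refine Finset.prod_le_one (fun i _ => Finset.sum_nonneg fun a _ => hw0 _) fun i _ => ?_
    simp only [hw]
    rw [← Finset.sum_div]
    refine div_le_one_of_le₀ (le_of_eq ?_) (hb0 _)
    simp only [push, Fintype.sum_prod_type]
    refine Finset.sum_congr rfl fun a _ => ?_
    simp
  have h2 : ∑ t ∈ S, ∏ i, w (t i, s i) ≤ 1 :=
    (Finset.sum_le_sum_of_subset_of_nonneg (Finset.subset_univ S) fun t _ _ =>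
      Finset.prod_nonneg fun i _ => hw0 _).trans hsum
  rw [Finset.sum_congr rfl key, Finset.sum_const, nsmul_eq_mul, Real.rpow_neg two_pos.le,
    ← div_eq_mul_inv, div_le_one (by positivity)] at h2
  exact h2

/-- At most `2 ^ (n H(Q))` words have empirical distribution `Q`. -/
theorem card_type_le {n : ℕ} (hn : 0 < n) (Q : A → ℝ) :
    ((Finset.univ.filter fun t : Fin n → A => emp t = Q).card : ℝ) ≤ 2 ^ (n * ent Q) := by
  set S := Finset.univ.filter fun t : Fin n → A => emp t = Q with hS
  by_cases hne : S.Nonempty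
  swap
  · rw [Finset.not_nonempty_iff_eq_empty.1 hne]
    simp only [Finset.card_empty, Nat.cast_zero]
    positivity
  obtain ⟨t₀, ht₀⟩ := hne
  have hQ : Q ∈ stdSimplex ℝ A := by
    rw [← (Finset.mem_filter.1 ht₀).2]
    exact emp_mem_stdSimplex hn _
  have key : ∀ t ∈ S, ∏ i, Q (t i) = (2 : ℝ) ^ (-(n * ent Q)) := by
    intro t ht
    have hE := (Finset.mem_filter.1 ht).2
    rw [prod_eq_rpow hn t fun i => by rw [← hE]; exact emp_apply_pos t i, hE, sum_mul_logb_self]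
    congr 1
    ring
  have hsum : ∑ t : Fin n → A, ∏ i, Q (t i) ≤ 1 := by
    rw [sum_prod_eq fun _ a => Q a]
    simp [hQ.2]
  have h2 : ∑ t ∈ S, ∏ i, Q (t i) ≤ 1 :=
    (Finset.sum_le_sum_of_subset_of_nonneg (Finset.subset_univ S) fun t _ _ =>
      Finset.prod_nonneg fun i _ => hQ.1 _).trans hsum
  rw [Finset.sum_congr rfl key, Finset.sum_const, nsmul_eq_mul, Real.rpow_neg two_pos.le,
    ← div_eq_mul_inv, div_le_one (by positivity)] at h2
  exact h2

end Basics

/-! ### Expectations over independent draws -/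

section Draws

open scoped Classical

set_option linter.unusedSectionVars false

variable {α ι : Type*} [Fintype α] [Fintype ι] [DecidableEq ι]

/-- The probability of the family `u` under independent draws from `μ`. -/
def iidWeight (μ : α → ℝ) (u : ι → α) : ℝ := ∏ j, μ (u j)

theorem iidWeight_nonneg {μ : α → ℝ} (hμ : ∀ a, 0 ≤ μ a) (u : ι → α) : 0 ≤ iidWeight μ u :=
  Finset.prod_nonneg fun _ _ => hμ _

theorem sum_iidWeight_mul_prod (μ : α → ℝ) (f : ι → α → ℝ) :
    ∑ u, iidWeight μ u * ∏ j, f j (u j) = ∏ j, ∑ a, μ a * f j a := by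
  rw [← sum_prod_eq fun j a => μ a * f j a]
  exact Finset.sum_congr rfl fun u _ => by rw [iidWeight, Finset.prod_mul_distrib]

theorem sum_iidWeight {μ : α → ℝ} (hμ : ∑ a, μ a = 1) : ∑ u : ι → α, iidWeight μ u = 1 := by
  have := sum_iidWeight_mul_prod (ι := ι) μ fun _ _ => 1
  simpa [hμ] using this

theorem iidWeight_mem_stdSimplex {μ : α → ℝ} (hμ : μ ∈ stdSimplex ℝ α) :
    iidWeight μ ∈ stdSimplex ℝ (ι → α) :=
  ⟨iidWeight_nonneg hμ.1, sum_iidWeight hμ.2⟩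

theorem exists_le_of_sum_mul_le {Ω : Type*} [Fintype Ω] {p : Ω → ℝ} (hp : p ∈ stdSimplex ℝ Ω)
    {F : Ω → ℝ} {c : ℝ} (h : ∑ ω, p ω * F ω ≤ c) : ∃ ω, F ω ≤ c := by
  by_contra! hlt
  have hne : ∃ ω, 0 < p ω := by
    by_contra! h0
    have : ∑ ω, p ω ≤ 0 := Finset.sum_nonpos fun ω _ => h0 ω
    rw [hp.2] at this
    norm_num at this
  obtain ⟨ω₀, h₀⟩ := hne
  have h1 : ∑ ω, p ω * c < ∑ ω, p ω * F ω :=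
    Finset.sum_lt_sum (fun ω _ => mul_le_mul_of_nonneg_left (hlt ω).le (hp.1 ω))
      ⟨ω₀, Finset.mem_univ _, mul_lt_mul_of_pos_left (hlt ω₀) h₀⟩
  rw [← Finset.sum_mul, hp.2, one_mul] at h1
  linarith

/-- Expanding `f` in indicators of the two values turns each summand into a product over
coordinates; the other coordinates contribute total mass one. -/
theorem sum_iidWeight_pair {μ : α → ℝ} (hμ : ∑ a, μ a = 1) {i j : ι} (hij : i ≠ j)
    (f : α → α → ℝ) :
    ∑ u, iidWeight μ u * f (u i) (u j) = ∑ a, ∑ b, μ a * μ b * f a b := by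
  have h1 : ∀ u : ι → α, f (u i) (u j) = ∑ a, ∑ b, f a b *
      ∏ k, (if k = i then if u k = a then (1 : ℝ) else 0 else 1) *
        (if k = j then if u k = b then (1 : ℝ) else 0 else 1) := by
    intro u
    simp only [Finset.prod_mul_distrib, Finset.prod_ite_eq', Finset.mem_univ, if_true]
    rw [Finset.sum_eq_single (u i), Finset.sum_eq_single (u j)]
    · simp
    · intro b _ hb
      simp [hb.symm]
    · simp
    · intro a _ ha
      simp [ha.symm]
    · simp
  simp only [h1, Finset.mul_sum]
  rw [Finset.sum_comm]
  refine Finset.sum_congr rfl fun a _ => ?_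
  rw [Finset.sum_comm]
  refine Finset.sum_congr rfl fun b _ => ?_
  have h2 := sum_iidWeight_mul_prod μ fun (k : ι) c =>
    (if k = i then if c = a then (1 : ℝ) else 0 else 1) *
        (if k = j then if c = b then (1 : ℝ) else 0 else 1)
  calc _ = (∑ u, iidWeight μ u * ∏ k, (if k = i then if u k = a then (1 : ℝ) else 0 else 1) *
        (if k = j then if u k = b then (1 : ℝ) else 0 else 1)) * f a b := by
        rw [Finset.sum_mul]
        exact Finset.sum_congr rfl fun u _ => by ring
    _ = (∏ k, (if k = i then μ a else 1) * (if k = j then μ b else 1)) * f a b := by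
        rw [h2]
        congr 1
        refine Finset.prod_congr rfl fun k _ => ?_
        by_cases hki : k = i
        · have hkj : k ≠ j := fun h => hij (hki.symm.trans h)
          simp [hki, hij]
        · by_cases hkj : k = j
          · simp [hkj, hij.symm]
          · simp [hki, hkj, hμ]
    _ = _ := by
        rw [Finset.prod_mul_distrib]
        simp

/-- Independent draws all miss `S` with probability `(1 - p) ^ |ι|`, and `1 - p ≤ exp (-p)`. -/
theorem sum_iidWeight_miss_le {μ : α → ℝ} (hμ : μ ∈ stdSimplex ℝ α) (S : α → Prop) :
    ∑ u : ι → α, iidWeight μ u * (if ∀ j, ¬S (u j) then 1 else 0) ≤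
      Real.exp (-(Fintype.card ι * ∑ a, μ a * if S a then 1 else 0)) := by
  have h := sum_iidWeight_mul_prod (ι := ι) μ fun _ a => if S a then 0 else 1
  have h1 : ∑ a, μ a * (if S a then (0 : ℝ) else 1) = 1 - ∑ a, μ a * if S a then 1 else 0 := by
    refine eq_sub_of_add_eq ?_
    rw [← Finset.sum_add_distrib]
    exact (Finset.sum_congr rfl fun a _ => by split_ifs <;> ring).trans hμ.2
  have h2 : ∀ u : ι → α, (if ∀ j, ¬S (u j) then (1 : ℝ) else 0) =
      ∏ j, if S (u j) then 0 else 1 := by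
    intro u
    by_cases hu : ∀ j, ¬S (u j)
    · simp [hu]
    · rw [if_neg hu]
      push Not at hu
      obtain ⟨j, hj⟩ := hu
      exact (Finset.prod_eq_zero (Finset.mem_univ j) (by simp [hj])).symm
  simp only [h2]
  rw [h, h1, Finset.prod_const, Finset.card_univ]
  set p := ∑ a, μ a * if S a then (1 : ℝ) else 0
  have hp1 : 0 ≤ 1 - p := by
    rw [← h1]
    exact Finset.sum_nonneg fun a _ => mul_nonneg (hμ.1 a) (by split_ifs <;> simp)
  calc (1 - p) ^ Fintype.card ι ≤ (Real.exp (-p)) ^ Fintype.card ι :=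
        pow_le_pow_left₀ hp1 (by linarith [Real.add_one_le_exp (-p)]) _
    _ = _ := by rw [← Real.exp_nat_mul]; congr 1; ring

/-- Markov's inequality for `2 ^ count`, whose mean is `(1 + p) ^ |ι|`. -/
theorem sum_iidWeight_count_le {μ : α → ℝ} (hμ : μ ∈ stdSimplex ℝ α) (S : α → Prop) (t : ℕ) :
    ∑ u : ι → α, iidWeight μ u * (if t ≤ (Finset.univ.filter fun j => S (u j)).card then 1 else 0) ≤
      Real.exp (Fintype.card ι * ∑ a, μ a * if S a then 1 else 0) / 2 ^ t := by
  have h := sum_iidWeight_mul_prod (ι := ι) μ fun _ a => if S a then 2 else 1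
  have h1 : ∑ a, μ a * (if S a then (2 : ℝ) else 1) = 1 + ∑ a, μ a * if S a then 1 else 0 := by
    refine Eq.trans (b := ∑ a, (μ a + μ a * if S a then 1 else 0))
      (Finset.sum_congr rfl fun a _ => by split_ifs <;> ring) ?_
    rw [Finset.sum_add_distrib, hμ.2]
  have h2 : ∀ u : ι → α, (if t ≤ (Finset.univ.filter fun j => S (u j)).card then (1 : ℝ) else 0) ≤
      (∏ j, if S (u j) then (2 : ℝ) else 1) / 2 ^ t := by
    intro u
    rw [Finset.prod_ite, Finset.prod_const, Finset.prod_const_one, mul_one]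
    split_ifs with ht
    · rw [le_div_iff₀ (by positivity), one_mul]
      exact pow_le_pow_right₀ (by norm_num) ht
    · positivity
  set p := ∑ a, μ a * if S a then (1 : ℝ) else 0
  have hp0 : 0 ≤ p := Finset.sum_nonneg fun a _ => mul_nonneg (hμ.1 a) (by split_ifs <;> simp)
  calc _ ≤ ∑ u : ι → α, iidWeight μ u * ((∏ j, if S (u j) then (2 : ℝ) else 1) / 2 ^ t) :=
        Finset.sum_le_sum fun u _ => mul_le_mul_of_nonneg_left (h2 u) (iidWeight_nonneg hμ.1 u)
    _ = (1 + p) ^ Fintype.card ι / 2 ^ t := by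
        simp only [← mul_div_assoc]
        rw [← Finset.sum_div, h, h1, Finset.prod_const, Finset.card_univ]
    _ ≤ (Real.exp p) ^ Fintype.card ι / 2 ^ t := by
        gcongr
        linarith [Real.add_one_le_exp p]
    _ = _ := by rw [← Real.exp_nat_mul]

/-- A Chernoff bound for a sum of independent centred variables bounded by one. -/
theorem sum_prod_chernoff_le {n : ℕ} (w f : Fin n → α → ℝ) (hw : ∀ i, w i ∈ stdSimplex ℝ α)
    (hf : ∀ i a, |f i a| ≤ 1) (h0 : ∀ i, ∑ a, w i a * f i a = 0) {δ : ℝ} (hδ : 0 < δ)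
    (hδ1 : δ ≤ 1) :
    ∑ u : Fin n → α, (∏ i, w i (u i)) * (if n * δ ≤ ∑ i, f i (u i) then 1 else 0) ≤
      Real.exp (-(n * (δ ^ 2 / 4))) := by
  have hw0 : ∀ u : Fin n → α, 0 ≤ ∏ i, w i (u i) := fun u =>
    Finset.prod_nonneg fun i _ => (hw i).1 _
  -- The minimizer of `s ^ 2 - δ s`, the exponent per letter obtained from `exp v ≤ 1 + v + v ^ 2`.
  set s := δ / 2 with hs
  have h2 : ∀ u : Fin n → α, (if n * δ ≤ ∑ i, f i (u i) then (1 : ℝ) else 0) ≤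
      Real.exp (-(n * (δ * s))) * ∏ i, Real.exp (s * f i (u i)) := by
    intro u
    rw [← Real.exp_sum, ← Real.exp_add, ← Finset.mul_sum]
    split_ifs with ht
    · refine Real.one_le_exp ?_
      nlinarith
    · positivity
  have h3 : ∀ i, ∑ a, w i a * Real.exp (s * f i a) ≤ Real.exp (s ^ 2) := by
    intro i
    have h4 : ∀ a, Real.exp (s * f i a) ≤ 1 + s * f i a + s ^ 2 := by
      intro a
      have hb : |s * f i a| ≤ s := by
        rw [abs_mul, abs_of_pos (by positivity)]
        exact mul_le_of_le_one_right (by positivity) (hf i a)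
      have := abs_le.1 (Real.abs_exp_sub_one_sub_id_le (hb.trans (by linarith)))
      have hsq : (s * f i a) ^ 2 ≤ s ^ 2 := sq_le_sq' (by linarith [abs_le.1 hb]) (abs_le.1 hb).2
      linarith
    calc _ ≤ ∑ a, w i a * (1 + s * f i a + s ^ 2) :=
          Finset.sum_le_sum fun a _ => mul_le_mul_of_nonneg_left (h4 a) ((hw i).1 a)
      _ = (1 + s ^ 2) * ∑ a, w i a + s * ∑ a, w i a * f i a := by
          rw [Finset.mul_sum, Finset.mul_sum, ← Finset.sum_add_distrib]
          exact Finset.sum_congr rfl fun a _ => by ring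
      _ = s ^ 2 + 1 := by rw [h0, (hw i).2]; ring
      _ ≤ _ := Real.add_one_le_exp _
  calc _ ≤ ∑ u : Fin n → α, (∏ i, w i (u i)) *
          (Real.exp (-(n * (δ * s))) * ∏ i, Real.exp (s * f i (u i))) :=
        Finset.sum_le_sum fun u _ => mul_le_mul_of_nonneg_left (h2 u) (hw0 u)
    _ = Real.exp (-(n * (δ * s))) * ∏ i, ∑ a, w i a * Real.exp (s * f i a) := by
        rw [← sum_prod_eq fun i a => w i a * Real.exp (s * f i a), Finset.mul_sum]
        refine Finset.sum_congr rfl fun u _ => ?_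
        rw [Finset.prod_mul_distrib]
        ring
    _ ≤ Real.exp (-(n * (δ * s))) * ∏ _i : Fin n, Real.exp (s ^ 2) := by
        refine mul_le_mul_of_nonneg_left (Finset.prod_le_prod (fun i _ => ?_) fun i _ => h3 i)
          (by positivity)
        exact Finset.sum_nonneg fun a _ => mul_nonneg ((hw i).1 a) (by positivity)
    _ = _ := by
        rw [Finset.prod_const, Finset.card_univ, Fintype.card_fin, ← Real.exp_nat_mul,
          ← Real.exp_add]
        congr 1
        rw [hs]
        ring

end Draws

/-! ### Entropy inequalities, typical outputs and the covering lemma -/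

section Covering

open scoped Classical

set_option linter.unusedSectionVars false

variable {A B X U : Type*} [Fintype A] [Fintype B] [Fintype X] [Fintype U]

/-- Gibbs' inequality. -/
theorem ent_le_cross {Q G : A → ℝ} (hQ : Q ∈ stdSimplex ℝ A) (hG : G ∈ stdSimplex ℝ A)
    (h : ∀ a, G a = 0 → Q a = 0) : ent Q ≤ -∑ a, Q a * Real.logb 2 (G a) := by
  have hl : 0 < Real.log 2 := Real.log_pos one_lt_two
  have h1 : ∀ a, Q a * Real.logb 2 (G a) + -(Q a * Real.logb 2 (Q a)) ≤
      (G a - Q a) / Real.log 2 := by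
    intro a
    by_cases hq : Q a = 0
    · simp only [hq, zero_mul, neg_zero, add_zero, sub_zero]
      exact div_nonneg (hG.1 a) hl.le
    · have hq0 : 0 < Q a := lt_of_le_of_ne (hQ.1 a) (Ne.symm hq)
      have hg0 : 0 < G a := lt_of_le_of_ne (hG.1 a) fun h' => hq (h a h'.symm)
      have h2 := Real.log_le_sub_one_of_pos (div_pos hg0 hq0)
      rw [Real.log_div hg0.ne' hq] at h2
      rw [Real.logb, Real.logb, le_div_iff₀ hl]
      calc _ = Q a * (Real.log (G a) - Real.log (Q a)) := by field_simp; ring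
        _ ≤ Q a * (G a / Q a - 1) := mul_le_mul_of_nonneg_left h2 hq0.le
        _ = _ := by field_simp
  have h3 := Finset.sum_le_sum fun a (_ : a ∈ Finset.univ) => h1 a
  rw [Finset.sum_add_distrib, ← Finset.sum_div, Finset.sum_sub_distrib, hQ.2, hG.2, sub_self,
    zero_div] at h3
  simp only [ent]
  linarith

/-- The joint distribution of input and output of a channel. -/
def joint (Q : A → ℝ) (V : A → B → ℝ) (p : A × B) : ℝ := Q p.1 * V p.1 p.2

theorem push_fst_joint {V : A → B → ℝ} (hV : IsChannel V) (Q : A → ℝ) :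
    push Prod.fst (joint Q V) = Q := by
  funext a
  simp only [push, joint, Fintype.sum_prod_type]
  rw [Finset.sum_eq_single a]
  · simp [← Finset.mul_sum, (hV a).2]
  · intro b _ hb
    simp [hb]
  · simp

theorem push_snd_apply (J : A × B → ℝ) (b : B) : push Prod.snd J b = ∑ a, J (a, b) := by
  simp only [push, Fintype.sum_prod_type]
  exact Finset.sum_congr rfl fun a _ => by simp

theorem push_fst_apply (J : A × B → ℝ) (a : A) : push Prod.fst J a = ∑ b, J (a, b) := by
  simp only [push, Fintype.sum_prod_type]
  rw [Finset.sum_eq_single a]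
  · simp
  · intro b _ hb
    simp [hb]
  · simp

theorem joint_mem_stdSimplex {Q : A → ℝ} (hQ : Q ∈ stdSimplex ℝ A) {V : A → B → ℝ}
    (hV : IsChannel V) : joint Q V ∈ stdSimplex ℝ (A × B) := by
  refine ⟨fun p => mul_nonneg (hQ.1 _) ((hV _).1 _), ?_⟩
  rw [← sum_push Prod.fst, push_fst_joint hV, hQ.2]

theorem sum_joint_mul_logb {Q : A → ℝ} (V : A → B → ℝ) :
    ∑ p, joint Q V p * Real.logb 2 (V p.1 p.2) = -condEntropy Q V := by
  simp only [joint, condEntropy, Fintype.sum_prod_type, Finset.mul_sum, ← Finset.sum_neg_distrib]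
  exact Finset.sum_congr rfl fun a _ => Finset.sum_congr rfl fun b _ => by ring

theorem ent_joint {Q : A → ℝ} {V : A → B → ℝ} (hV : IsChannel V) :
    ent (joint Q V) = ent Q + condEntropy Q V := by
  have h : ∀ p, joint Q V p * Real.logb 2 (joint Q V p) =
      joint Q V p * Real.logb 2 (Q p.1) + joint Q V p * Real.logb 2 (V p.1 p.2) := by
    intro p
    by_cases h1 : Q p.1 = 0
    · simp [joint, h1]
    by_cases h2 : V p.1 p.2 = 0
    · simp [joint, h2]
    simp only [joint]
    rw [Real.logb_mul h1 h2]
    ring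
  have h1 := sum_mul_logb_self (joint Q V)
  rw [Finset.sum_congr rfl fun p _ => h p, Finset.sum_add_distrib, sum_joint_mul_logb,
    ← sum_push_mul Prod.fst (joint Q V) fun a => Real.logb 2 (Q a), push_fst_joint hV,
    sum_mul_logb_self] at h1
  linarith

/-- Conditioning reduces entropy. -/
theorem condEntropy_le_ent {Q : A → ℝ} (hQ : Q ∈ stdSimplex ℝ A) {V : A → B → ℝ}
    (hV : IsChannel V) : condEntropy Q V ≤ ent (push Prod.snd (joint Q V)) := by
  set G := push Prod.snd (joint Q V) with hG
  have hJ := joint_mem_stdSimplex hQ hV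
  have hGs : G ∈ stdSimplex ℝ B := push_mem_stdSimplex hJ _
  -- Gibbs' inequality for each row against the output law; averaging over `Q` turns the right side
  -- into the output entropy.
  have h1 : ∀ a, Q a * ∑ b, -(V a b * Real.logb 2 (V a b)) ≤
      Q a * -∑ b, V a b * Real.logb 2 (G b) := by
    intro a
    by_cases ha : Q a = 0
    · simp [ha]
    refine mul_le_mul_of_nonneg_left (ent_le_cross (hV a) hGs fun b hb => ?_) (hQ.1 a)
    have h2 := le_push (g := Prod.snd) hJ.1 (a, b)
    have h3 : joint Q V (a, b) = 0 := le_antisymm (h2.trans_eq hb) (hJ.1 _)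
    exact (mul_eq_zero.1 h3).resolve_left ha
  refine (Finset.sum_le_sum fun a _ => h1 a).trans (le_of_eq ?_)
  have h4 := sum_mul_logb_push Prod.snd (joint Q V)
  rw [← hG] at h4
  rw [← neg_eq_iff_eq_neg.2 h4, Fintype.sum_prod_type, ← Finset.sum_neg_distrib]
  refine Finset.sum_congr rfl fun a _ => ?_
  rw [mul_neg, Finset.mul_sum]
  congr 1
  exact Finset.sum_congr rfl fun b _ => by simp only [joint]; ring

/-- A strictly positive distribution almost as efficient as `Q` for coding `Q`. -/
theorem exists_pos_cross_le [Nonempty A] {Q : A → ℝ} (hQ : Q ∈ stdSimplex ℝ A) {δ : ℝ}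
    (hδ : 0 < δ) :
    ∃ G ∈ stdSimplex ℝ A, (∀ a, 0 < G a) ∧ -∑ a, Q a * Real.logb 2 (G a) ≤ ent Q + δ := by
  -- Mixing `Q` with the uniform law at weight `s` costs at most `-log₂ s = δ` bits.
  set s : ℝ := 2 ^ (-δ) with hs
  have hs0 : 0 < s := by positivity
  have hs1 : s < 1 := Real.rpow_lt_one_of_one_lt_of_neg one_lt_two (by linarith)
  have hc : (0 : ℝ) < Fintype.card A := by exact_mod_cast Fintype.card_pos
  have hpos : ∀ a, s * Q a < s * Q a + (1 - s) / Fintype.card A := fun a => by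
    have : 0 < (1 - s) / Fintype.card A := div_pos (by linarith) hc
    linarith
  refine ⟨fun a => s * Q a + (1 - s) / Fintype.card A, ⟨fun a => ?_, ?_⟩, fun a => ?_, ?_⟩
  · exact (mul_nonneg hs0.le (hQ.1 a)).trans (hpos a).le
  · rw [Finset.sum_add_distrib, ← Finset.mul_sum, hQ.2, Finset.sum_const, Finset.card_univ,
      nsmul_eq_mul]
    field_simp
    ring
  · exact (mul_nonneg hs0.le (hQ.1 a)).trans_lt (hpos a)
  · have h1 : ∀ a, Q a * Real.logb 2 (Q a) - Q a * δ ≤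
        Q a * Real.logb 2 (s * Q a + (1 - s) / Fintype.card A) := by
      intro a
      by_cases ha : Q a = 0
      · simp [ha]
      have ha0 : 0 < Q a := lt_of_le_of_ne (hQ.1 a) (Ne.symm ha)
      rw [← mul_sub]
      refine mul_le_mul_of_nonneg_left ?_ ha0.le
      have h2 : Real.logb 2 (s * Q a) = Real.logb 2 (Q a) - δ := by
        rw [Real.logb_mul hs0.ne' ha, hs, Real.logb_rpow two_pos (by norm_num)]
        ring
      rw [← h2]
      exact Real.logb_le_logb_of_le one_lt_two (by positivity) (hpos a).le
    have h3 := Finset.sum_le_sum fun a (_ : a ∈ Finset.univ) => h1 a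
    rw [Finset.sum_sub_distrib, ← Finset.sum_mul, hQ.2, sum_mul_logb_self] at h3
    linarith

/-- The words `u` that are an admissible description of `x`. -/
def Admissible (W : X → U → ℝ) (N : Set (X × U → ℝ)) {n : ℕ} (x : Fin n → X) (u : Fin n → U) :
    Prop :=
  emp (fun i => (x i, u i)) ∈ N ∧ ∀ i, 0 < W (x i) (u i)

theorem eventually_mul_exp_neg_le (C : ℝ) {a ε : ℝ} (ha : 0 < a) (hε : 0 < ε) :
    ∀ᶠ n : ℕ in Filter.atTop, C * Real.exp (-(n * a)) ≤ ε := by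
  have h1 : Filter.Tendsto (fun n : ℕ => C * Real.exp (-(n * a))) Filter.atTop (𝓝 (C * 0)) :=
    (Real.tendsto_exp_neg_atTop_nhds_zero.comp
      (tendsto_natCast_atTop_atTop.atTop_mul_const ha)).const_mul C
  rw [mul_zero] at h1
  exact (h1.eventually_lt_const hε).mono fun n hn => hn.le

/-- The typical outputs of a channel have almost full probability. -/
theorem eventually_typical {W : X → U → ℝ} (hW : IsChannel W) {δ : ℝ} (hδ : 0 < δ) :
    ∀ᶠ n : ℕ in Filter.atTop, ∀ x : Fin n → X, 1 / 2 ≤ ∑ u : Fin n → U, (∏ i, W (x i) (u i)) *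
      if ∀ p : X × U, |emp (fun i => (x i, u i)) p - joint (emp x) W p| < δ then 1 else 0 := by
  -- The Chernoff bound requires a deviation of at most one.
  set ε := min δ 1 with hε
  have hε0 : 0 < ε := lt_min hδ one_pos
  have hε1 : ε ≤ 1 := min_le_right _ _
  have hev := eventually_mul_exp_neg_le (Fintype.card (X × U) * 2) (a := ε ^ 2 / 4) (ε := 1 / 2)
    (by positivity) (by norm_num)
  filter_upwards [hev, Filter.eventually_gt_atTop 0] with n hn hn0 x
  have hn0' : (0 : ℝ) < n := by exact_mod_cast hn0
  -- Centred indicators of the pair `p` at position `i`; their sum is `n` times the deviation of the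
  -- joint type from its mean. The Chernoff bound is applied to both signs.
  set f : X × U → Fin n → U → ℝ := fun p i b =>
    if x i = p.1 then (if b = p.2 then 1 else 0) - W p.1 p.2 else 0 with hf
  have hfs : ∀ p (u : Fin n → U), ∑ i, f p i (u i) =
      n * (emp (fun i => (x i, u i)) p - joint (emp x) W p) := by
    intro p u
    have h1 : n * emp (fun i => (x i, u i)) p = ∑ i, if (x i, u i) = p then (1 : ℝ) else 0 := by
      simp only [emp]
      field_simp
      exact Finset.sum_congr rfl fun i _ => by congr
    have h2 : n * joint (emp x) W p = ∑ i, (if x i = p.1 then (1 : ℝ) else 0) * W p.1 p.2 := by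
      simp only [emp, joint]
      rw [← Finset.sum_mul]
      field_simp
    rw [mul_sub, h1, h2, ← Finset.sum_sub_distrib]
    refine Finset.sum_congr rfl fun i _ => ?_
    simp only [hf, Prod.ext_iff]
    by_cases hx : x i = p.1 <;> simp [hx]
  have hw0 : ∀ u : Fin n → U, 0 ≤ ∏ i, W (x i) (u i) := fun u =>
    Finset.prod_nonneg fun i _ => (hW _).1 _
  have hw1 : ∑ u : Fin n → U, ∏ i, W (x i) (u i) = 1 := by
    rw [sum_prod_eq fun i b => W (x i) b]
    exact Finset.prod_eq_one fun i _ => (hW (x i)).2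
  have hfabs : ∀ p i b, |f p i b| ≤ 1 := by
    intro p i b
    have h0 := (hW p.1).1 p.2
    have h1 : W p.1 p.2 ≤ 1 := by
      rw [← (hW p.1).2]
      exact Finset.single_le_sum (fun b _ => (hW p.1).1 b) (Finset.mem_univ p.2)
    simp only [hf]
    rw [abs_le]
    split_ifs <;> constructor <;> linarith
  have hfmean : ∀ p i, ∑ b, W (x i) b * f p i b = 0 := by
    intro p i
    simp only [hf]
    by_cases hx : x i = p.1
    · simp [hx, mul_sub, ← Finset.sum_mul, (hW p.1).2]
    · simp [hx]
  have hc1 : ∀ p, ∑ u : Fin n → U, (∏ i, W (x i) (u i)) *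
      (if n * ε ≤ ∑ i, f p i (u i) then 1 else 0) ≤ Real.exp (-(n * (ε ^ 2 / 4))) := fun p =>
    sum_prod_chernoff_le (fun i => W (x i)) (f p) (fun i => hW _) (hfabs p) (hfmean p) hε0 hε1
  have hc2 : ∀ p, ∑ u : Fin n → U, (∏ i, W (x i) (u i)) *
      (if n * ε ≤ ∑ i, -f p i (u i) then 1 else 0) ≤ Real.exp (-(n * (ε ^ 2 / 4))) := fun p =>
    sum_prod_chernoff_le (fun i => W (x i)) (fun i b => -f p i b) (fun i => hW _)
      (fun i b => by rw [abs_neg]; exact hfabs p i b)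
      (fun i => by simp only [mul_neg, Finset.sum_neg_distrib, hfmean, neg_zero]) hε0 hε1
  have hind : ∀ u : Fin n → U,
      1 - ∑ p, ((if n * ε ≤ ∑ i, f p i (u i) then (1 : ℝ) else 0) +
        if n * ε ≤ ∑ i, -f p i (u i) then 1 else 0) ≤
      if ∀ p : X × U, |emp (fun i => (x i, u i)) p - joint (emp x) W p| < δ then 1 else 0 := by
    intro u
    have hnn : ∀ p, 0 ≤ (if n * ε ≤ ∑ i, f p i (u i) then (1 : ℝ) else 0) +
        if n * ε ≤ ∑ i, -f p i (u i) then 1 else 0 := fun p => by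
      split_ifs <;> norm_num
    split_ifs with hu
    · linarith [Finset.sum_nonneg fun p (_ : p ∈ Finset.univ) => hnn p]
    · push Not at hu
      obtain ⟨p, hp⟩ := hu
      have h1 := Finset.single_le_sum (fun p _ => hnn p) (Finset.mem_univ p)
      have h2 : (1 : ℝ) ≤ (if n * ε ≤ ∑ i, f p i (u i) then (1 : ℝ) else 0) +
          if n * ε ≤ ∑ i, -f p i (u i) then 1 else 0 := by
        rw [Finset.sum_neg_distrib, hfs]
        have hp' : ε ≤ |emp (fun i => (x i, u i)) p - joint (emp x) W p| :=
          (min_le_left _ _).trans hp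
        rcases le_abs.1 hp' with h | h
        · rw [if_pos (mul_le_mul_of_nonneg_left h hn0'.le)]
          split_ifs <;> norm_num
        · rw [← mul_neg, add_comm, if_pos (mul_le_mul_of_nonneg_left h hn0'.le)]
          split_ifs <;> norm_num
      linarith
  refine le_trans ?_ (Finset.sum_le_sum fun u _ => mul_le_mul_of_nonneg_left (hind u) (hw0 u))
  simp only [mul_sub, mul_one, Finset.sum_sub_distrib, hw1, Finset.mul_sum, mul_add]
  rw [Finset.sum_comm]
  have h3 := Finset.sum_le_sum fun p (_ : p ∈ Finset.univ) => add_le_add (hc1 p) (hc2 p)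
  simp only [← Finset.sum_add_distrib] at h3
  rw [Finset.sum_const, Finset.card_univ, nsmul_eq_mul] at h3
  linarith

/-- Covering: a random word is admissible for `x` with probability about `2 ^ (-n I(X; U))`. -/
theorem exists_nhds_admissible {W : X → U → ℝ} (hW : IsChannel W) (QX : X → ℝ)
    {N : Set (X × U → ℝ)} (hN : N ∈ 𝓝 (joint QX W)) {G : U → ℝ} (hG : ∀ b, 0 < G b) {c : ℝ}
    (hc : -condEntropy QX W - ∑ b, push Prod.snd (joint QX W) b * Real.logb 2 (G b) < c) :
    ∃ Ω ∈ 𝓝 QX, ∀ᶠ n : ℕ in Filter.atTop, ∀ x : Fin n → X, emp x ∈ Ω →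
      (2 : ℝ) ^ (-(n * c)) ≤ ∑ u : Fin n → U, iidWeight G u * if Admissible W N x u then 1 else 0 := by
  obtain ⟨c', hc', hc'c⟩ := exists_between hc
  -- Change of measure: `Gⁿ(u)` is `Wⁿ(u | x)` times `2 ^ (-n Λ)` at the joint type of `(x, u)`.
  -- Typical outputs carry half of the `Wⁿ`-mass and have `Λ < c'`.
  set Λ : (X × U → ℝ) → ℝ := fun J => ∑ p, J p * (Real.logb 2 (W p.1 p.2) - Real.logb 2 (G p.2))
    with hΛ
  have hΛ0 : Λ (joint QX W) < c' := by
    refine lt_of_eq_of_lt ?_ hc'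
    simp only [hΛ, mul_sub, Finset.sum_sub_distrib]
    rw [sum_joint_mul_logb, sum_push_mul Prod.snd (joint QX W) fun b => Real.logb 2 (G b)]
  have hΛc : Continuous Λ := by fun_prop
  obtain ⟨r, hr, hball⟩ := Metric.mem_nhds_iff.1
    (Filter.inter_mem hN (hΛc.continuousAt.eventually_lt continuousAt_const hΛ0))
  refine ⟨Metric.ball QX (r / 2), Metric.ball_mem_nhds _ (by positivity), ?_⟩
  -- The gap between `c'` and `c` absorbs the factor one half.
  have hev := eventually_mul_exp_neg_le 1 (a := (c - c') * Real.log 2) (ε := 1 / 2)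
    (mul_pos (by linarith) (Real.log_pos one_lt_two)) (by norm_num)
  filter_upwards [eventually_typical hW (δ := r / 2) (by positivity), hev,
    Filter.eventually_gt_atTop 0] with n hn hexp hn0 x hx
  have hkey : ∀ u : Fin n → U, (∏ i, W (x i) (u i)) *
      (if ∀ p : X × U, |emp (fun i => (x i, u i)) p - joint (emp x) W p| < r / 2 then 1 else 0) *
        2 ^ (-(n * c')) ≤ iidWeight G u * if Admissible W N x u then 1 else 0 := by
    intro u
    have hRHS : 0 ≤ iidWeight G u * if Admissible W N x u then (1 : ℝ) else 0 :=
      mul_nonneg (iidWeight_nonneg (fun b => (hG b).le) u) (by split_ifs <;> simp)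
    by_cases hpos : ∀ i, 0 < W (x i) (u i)
    swap
    · push Not at hpos
      obtain ⟨i, hi⟩ := hpos
      rw [Finset.prod_eq_zero (Finset.mem_univ i) (le_antisymm hi ((hW _).1 _))]
      simpa using hRHS
    by_cases h : ∀ p : X × U, |emp (fun i => (x i, u i)) p - joint (emp x) W p| < r / 2
    swap
    · rw [if_neg h]
      simpa using hRHS
    have hmem : emp (fun i => (x i, u i)) ∈ Metric.ball (joint QX W) r := by
      rw [Metric.mem_ball]
      have h1 : dist (emp fun i => (x i, u i)) (joint (emp x) W) < r / 2 := by
        refine (dist_pi_lt_iff (by positivity)).2 fun p => ?_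
        rw [Real.dist_eq]
        exact h p
      have h2 : dist (joint (emp x) W) (joint QX W) ≤ dist (emp x) QX := by
        refine (dist_pi_le_iff dist_nonneg).2 fun p => ?_
        have h3 : W p.1 p.2 ≤ 1 := by
          rw [← (hW p.1).2]
          exact Finset.single_le_sum (fun b _ => (hW p.1).1 b) (Finset.mem_univ p.2)
        rw [Real.dist_eq, joint, joint, ← sub_mul, abs_mul, abs_of_nonneg ((hW p.1).1 p.2)]
        refine (mul_le_of_le_one_right (abs_nonneg _) h3).trans ?_
        rw [← Real.dist_eq]
        exact dist_le_pi_dist _ _ _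
      calc _ ≤ _ := dist_triangle _ _ _
        _ < r / 2 + r / 2 := add_lt_add_of_lt_of_le h1 (h2.trans (Metric.mem_ball.1 hx).le)
        _ = r := by ring
    have hin := hball hmem
    rw [if_pos h, if_pos (show Admissible W N x u from ⟨hin.1, hpos⟩), mul_one, mul_one]
    have hΛu : Λ (emp fun i => (x i, u i)) < c' := hin.2
    rw [prod_eq_rpow hn0 (fun i => (x i, u i)) (w := fun p => W p.1 p.2) hpos, iidWeight,
      prod_eq_rpow hn0 u fun i => hG _, ← Real.rpow_add two_pos]
    refine Real.rpow_le_rpow_of_exponent_le one_le_two ?_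
    have h4 : ∑ b, emp u b * Real.logb 2 (G b) =
        ∑ p, emp (fun i => (x i, u i)) p * Real.logb 2 (G p.2) := by
      rw [← sum_push_mul Prod.snd _ fun b => Real.logb 2 (G b), push_emp]
      rfl
    have h5 : Λ (emp fun i => (x i, u i)) =
        ∑ p, emp (fun i => (x i, u i)) p * Real.logb 2 (W p.1 p.2) -
          ∑ p, emp (fun i => (x i, u i)) p * Real.logb 2 (G p.2) := by
      simp only [hΛ, mul_sub, Finset.sum_sub_distrib]
    have hn0' : (0 : ℝ) < n := by exact_mod_cast hn0
    rw [h4]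
    nlinarith
  refine le_trans ?_ (Finset.sum_le_sum fun u _ => hkey u)
  rw [← Finset.sum_mul]
  refine le_trans ?_ (mul_le_mul_of_nonneg_right (hn x) (by positivity))
  have h6 : (2 : ℝ) ^ (-(n * c)) = Real.exp (-(n * ((c - c') * Real.log 2))) * 2 ^ (-(n * c')) := by
    rw [Real.rpow_def_of_pos two_pos, Real.rpow_def_of_pos two_pos, ← Real.exp_add]
    congr 1
    ring
  rw [h6]
  exact mul_le_mul_of_nonneg_right (by linarith) (by positivity)

end Covering

/-! ### Continuity and compactness of the single-letter quantities; comparison of the two bounds -/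

section SingleLetter

open scoped Classical

set_option linter.unusedSectionVars false

variable {A B X Y Z U : Type*} [Fintype A] [Fintype B] [Fintype X] [Fintype Y] [Fintype U]

/-- The marginal of `(X, U)`. -/
def pairXU (q : X × Y × U) : X × U := (q.1, q.2.2)

/-- `I(X; U)` in terms of entropies. -/
def infoXU (Q : X × Y × U → ℝ) : ℝ :=
  ent (push Prod.fst Q) + ent (push (fun q => q.2.2) Q) - ent (push pairXU Q)

/-- `I(Y; U)` in terms of entropies. -/
def infoYU (Q : X × Y × U → ℝ) : ℝ :=
  ent (push (fun q => q.2.1) Q) + ent (push (fun q => q.2.2) Q) - ent (push Prod.snd Q)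

/-- `D(Q ‖ P Q_{U|X})` in terms of entropies. -/
def divEnt (P : X × Y → ℝ) (Q : X × Y × U → ℝ) : ℝ :=
  ent (push pairXU Q) - ent Q - ent (push Prod.fst Q) -
    ∑ q, Q q * Real.logb 2 (P (q.1, q.2.1))

@[fun_prop]
theorem continuous_infoXU : Continuous (infoXU : (X × Y × U → ℝ) → ℝ) := by
  unfold infoXU
  fun_prop

@[fun_prop]
theorem continuous_infoYU : Continuous (infoYU : (X × Y × U → ℝ) → ℝ) := by
  unfold infoYU
  fun_prop

@[fun_prop]
theorem continuous_divEnt (P : X × Y → ℝ) : Continuous (divEnt P : (X × Y × U → ℝ) → ℝ) := by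
  unfold divEnt
  fun_prop

theorem mutualInfo_eq {J : A × B → ℝ} (hJ : ∀ p, 0 ≤ J p) :
    mutualInfo J = ent (push Prod.fst J) + ent (push Prod.snd J) - ent J := by
  have h : ∀ p, J p * Real.logb 2 (J p / ((∑ b', J (p.1, b')) * ∑ a', J (a', p.2))) =
      J p * Real.logb 2 (J p) - J p * Real.logb 2 (push Prod.fst J p.1) -
        J p * Real.logb 2 (push Prod.snd J p.2) := by
    intro p
    rw [← push_fst_apply, ← push_snd_apply]
    by_cases hp : J p = 0
    · simp [hp]
    have hp0 : 0 < J p := lt_of_le_of_ne (hJ p) (Ne.symm hp)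
    have h1 := hp0.trans_le (le_push (g := Prod.fst) hJ p)
    have h2 := hp0.trans_le (le_push (g := Prod.snd) hJ p)
    rw [Real.logb_div hp (mul_pos h1 h2).ne', Real.logb_mul h1.ne' h2.ne']
    ring
  have h1 : mutualInfo J =
      ∑ p, J p * Real.logb 2 (J p / ((∑ b', J (p.1, b')) * ∑ a', J (a', p.2))) := by
    rw [Fintype.sum_prod_type]
    rfl
  rw [h1, Finset.sum_congr rfl fun p _ => h p, Finset.sum_sub_distrib, Finset.sum_sub_distrib,
    sum_mul_logb_self, sum_mul_logb_push, sum_mul_logb_push]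
  ring

theorem push_pairXU_apply (Q : X × Y × U → ℝ) (p : X × U) :
    push pairXU Q p = ∑ y, Q (p.1, y, p.2) := by
  simp only [push, pairXU, Fintype.sum_prod_type]
  rw [Finset.sum_eq_single p.1]
  · refine Finset.sum_congr rfl fun y _ => ?_
    rw [Finset.sum_eq_single p.2]
    · simp
    · intro u _ hu
      exact if_neg fun h => hu (congrArg Prod.snd h)
    · simp
  · intro a _ ha
    exact Finset.sum_eq_zero fun y _ => Finset.sum_eq_zero fun u _ =>
      if_neg fun h => ha (congrArg Prod.fst h)
  · simp

theorem push_pairY_apply (Q : X × Y × U → ℝ) (y : Y) :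
    push (fun q : X × Y × U => q.2.1) Q y = ∑ x, ∑ u, Q (x, y, u) := by
  simp only [push, Fintype.sum_prod_type]
  refine Finset.sum_congr rfl fun x _ => ?_
  rw [Finset.sum_eq_single y]
  · simp
  · intro b _ hb
    simp [hb]
  · simp

theorem mutualInfo_XU_eq {Q : X × Y × U → ℝ} (hQ : ∀ q, 0 ≤ Q q) :
    (mutualInfo fun p : X × U => ∑ y, Q (p.1, y, p.2)) = infoXU Q := by
  have : (fun p : X × U => ∑ y, Q (p.1, y, p.2)) = push pairXU Q :=
    funext fun p => (push_pairXU_apply Q p).symm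
  rw [this, mutualInfo_eq (push_nonneg hQ), push_push, push_push]
  rfl

theorem mutualInfo_YU_eq {Q : X × Y × U → ℝ} (hQ : ∀ q, 0 ≤ Q q) :
    (mutualInfo fun p : Y × U => ∑ x, Q (x, p.1, p.2)) = infoYU Q := by
  have : (fun p : Y × U => ∑ x, Q (x, p.1, p.2)) = push Prod.snd Q :=
    funext fun p => (push_snd_apply Q p).symm
  rw [this, mutualInfo_eq (push_nonneg hQ), push_push, push_push]
  rfl

theorem mem_couplings_iff {m : ℕ} {QX : X → ℝ} {W : X → Fin m → ℝ} {QY : Y → ℝ}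
    {Q : X × Y × Fin m → ℝ} :
    Q ∈ couplings QX W QY ↔ Q ∈ stdSimplex ℝ (X × Y × Fin m) ∧ push pairXU Q = joint QX W ∧
      push (fun q => q.2.1) Q = QY := by
  simp only [couplings, Set.mem_ofPred_eq, funext_iff, push_pairXU_apply, push_pairY_apply,
    Prod.forall, joint]

theorem sum_eq_of_mem_couplings {m : ℕ} {QX : X → ℝ} {W : X → Fin m → ℝ} {QY : Y → ℝ}
    (hW : IsChannel W) {Q : X × Y × Fin m → ℝ} (hQ : Q ∈ couplings QX W QY) :
    (fun x => ∑ y, ∑ u, Q (x, y, u)) = QX := by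
  funext x
  rw [Finset.sum_comm, Finset.sum_congr rfl fun u _ => hQ.2.1 x u, ← Finset.mul_sum, (hW x).2,
    mul_one]

/-- On the support of `Q` the factor `W` is the conditional law of `U` given `X`, so it can be
expressed through the marginals of `Q`. The resulting formula is continuous in `Q` everywhere, as
`logb` vanishes at zero; the support condition is kept separately. -/
theorem divergence_eq_divEnt {m : ℕ} {P : X × Y → ℝ} {QX : X → ℝ} {W : X → Fin m → ℝ} {QY : Y → ℝ}
    (hW : IsChannel W) {Q : X × Y × Fin m → ℝ} (hQ : Q ∈ couplings QX W QY)
    (hdom : ∀ q, P (q.1, q.2.1) = 0 → Q q = 0) :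
    divergence Q (fun q => P (q.1, q.2.1) * W q.1 q.2.2) = (divEnt P Q : EReal) := by
  obtain ⟨hQs, hXU, -⟩ := mem_couplings_iff.1 hQ
  have hX : push Prod.fst Q = QX := by
    rw [← push_fst_joint hW QX, ← hXU, push_push]
    rfl
  have hW0 : ∀ q, Q q ≠ 0 → QX q.1 ≠ 0 ∧ W q.1 q.2.2 ≠ 0 := by
    intro q hq
    have h1 : 0 < push pairXU Q (pairXU q) :=
      (lt_of_le_of_ne (hQs.1 q) hq.symm).trans_le (le_push hQs.1 q)
    rw [hXU] at h1
    exact mul_ne_zero_iff.1 h1.ne'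
  have h1 : ∀ q : X × Y × Fin m, P (q.1, q.2.1) * W q.1 q.2.2 = 0 → Q q = 0 := by
    intro q hq
    by_contra hne
    rcases mul_eq_zero.1 hq with h | h
    · exact hne (hdom q h)
    · exact (hW0 q hne).2 h
  rw [divergence, if_pos h1]
  congr 1
  have h2 : ∀ q, Q q * Real.logb 2 (Q q / (P (q.1, q.2.1) * W q.1 q.2.2)) =
      Q q * Real.logb 2 (Q q) - Q q * Real.logb 2 (P (q.1, q.2.1)) -
        Q q * Real.logb 2 (push pairXU Q (pairXU q)) +
        Q q * Real.logb 2 (push Prod.fst Q q.1) := by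
    intro q
    by_cases hq : Q q = 0
    · simp [hq]
    have hP : P (q.1, q.2.1) ≠ 0 := fun h => hq (hdom q h)
    obtain ⟨ha, hb⟩ := hW0 q hq
    rw [hXU, hX]
    simp only [joint, pairXU]
    rw [Real.logb_div hq (mul_ne_zero hP hb), Real.logb_mul hP hb, Real.logb_mul ha hb]
    ring
  rw [Finset.sum_congr rfl fun q _ => h2 q, Finset.sum_add_distrib, Finset.sum_sub_distrib,
    Finset.sum_sub_distrib, sum_mul_logb_self, sum_mul_logb_push, sum_mul_logb_push, divEnt]
  ring

/-- The joint distributions at which the exponent falls to `L` or below. -/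
def badSet (P : X × Y → ℝ) (d : X → Z → ℝ) (R Δ L : ℝ) (b : Prop) (φ : Y → U → Z) :
    Set (X × Y × U → ℝ) :=
  {Q | Q ∈ stdSimplex ℝ (X × Y × U) ∧ (∀ q, P (q.1, q.2.1) = 0 → Q q = 0) ∧
    ((Δ ≤ ∑ q, Q q * d q.1 (φ q.2.1 q.2.2) ∧ divEnt P Q ≤ L) ∨
      (b ∧ divEnt P Q + max 0 (R - infoXU Q + infoYU Q) ≤ L))}

/-- All conditions are closed. This is why the second alternative omits the strict inequality `E d <
Δ`. -/
theorem isCompact_badSet (P : X × Y → ℝ) (d : X → Z → ℝ) (R Δ L : ℝ) (b : Prop) (φ : Y → U → Z) :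
    IsCompact (badSet P d R Δ L b φ) := by
  have h1 : IsClosed {Q : X × Y × U → ℝ | ∀ q, P (q.1, q.2.1) = 0 → Q q = 0} := by
    simp only [Set.ofPred_forall]
    exact isClosed_iInter fun q => isClosed_iInter fun _ =>
      isClosed_eq (by fun_prop) continuous_const
  have h2 : IsClosed {Q : X × Y × U → ℝ | Δ ≤ ∑ q, Q q * d q.1 (φ q.2.1 q.2.2)} :=
    isClosed_le continuous_const (by fun_prop)
  have h3 : IsClosed {Q : X × Y × U → ℝ | divEnt P Q ≤ L} :=
    isClosed_le (by fun_prop) continuous_const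
  have h4 : IsClosed {_Q : X × Y × U → ℝ | b} := isClosed_const
  have h5 : IsClosed {Q : X × Y × U → ℝ | divEnt P Q + max 0 (R - infoXU Q + infoYU Q) ≤ L} :=
    isClosed_le (by fun_prop) continuous_const
  exact (isCompact_stdSimplex ℝ (X × Y × U)).inter_right
    (h1.inter ((h2.inter h3).union (h4.inter h5)))

/-- Omitting the strict distortion inequality from the second alternative is harmless: if `E d ≥ Δ`,
that alternative still forces `D ≤ L`, since the added term is nonnegative. -/
theorem notMem_badSet {m : ℕ} {P : X × Y → ℝ} {d : X → Z → ℝ} {R Δ L : ℝ} {QX : X → ℝ}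
    {W : X → Fin m → ℝ} {QY : Y → ℝ} (hW : IsChannel W) {Q : X × Y × Fin m → ℝ}
    (hQ : Q ∈ couplings QX W QY) {φ : Y → Fin m → Z} (h : (L : EReal) < eta R Δ P d W φ Q) :
    Q ∉ badSet P d R Δ L (R ≤ kappa₂ P QX W) φ := by
  rintro ⟨hQs, hdom, hor⟩
  rw [eta, objective, sum_eq_of_mem_couplings hW hQ, divergence_eq_divEnt hW hQ hdom,
    mutualInfo_XU_eq hQs.1, mutualInfo_YU_eq hQs.1] at h
  by_cases hd : Δ ≤ ∑ q, Q q * d q.1 (φ q.2.1 q.2.2)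
  · rw [if_pos hd] at h
    have h' : L < divEnt P Q := by exact_mod_cast h
    rcases hor with ⟨-, h1⟩ | ⟨-, h1⟩
    · linarith
    · linarith [le_max_left 0 (R - infoXU Q + infoYU Q)]
  · rcases hor with ⟨h1, -⟩ | ⟨hb, h1⟩
    · exact hd h1
    · rw [if_neg hd, if_pos hb] at h
      have h' : L < divEnt P Q + max 0 (R - infoXU Q + infoYU Q) := by exact_mod_cast h
      linarith

/-- The reproduction function can be chosen on the basis of the type of the side information,
uniformly near the target joint distribution of source and description. -/
theorem exists_nhds_reproduction {m : ℕ} {P : X × Y → ℝ} {d : X → Z → ℝ} {R Δ L : ℝ}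
    {QX : X → ℝ} {W : X → Fin m → ℝ} (hW : IsChannel W)
    (h : ∀ QY ∈ stdSimplex ℝ Y, ∃ φ : Y → Fin m → Z, ∀ Q ∈ couplings QX W QY,
      (L : EReal) < eta R Δ P d W φ Q) :
    ∃ N ∈ 𝓝 (joint QX W), ∀ QY ∈ stdSimplex ℝ Y, ∃ φ : Y → Fin m → Z,
      ∀ Q, push pairXU Q ∈ N → push (fun q => q.2.1) Q = QY →
        Q ∉ badSet P d R Δ L (R ≤ kappa₂ P QX W) φ := by
  -- The neighbourhood `N` must not depend on `Q_Y`, while `φ` may; finite unions intersect the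
  -- neighbourhoods and keep the respective `φ`.
  refine (isCompact_stdSimplex ℝ Y).induction_on (p := fun s => ∃ N ∈ 𝓝 (joint QX W), ∀ QY ∈ s,
    ∃ φ : Y → Fin m → Z, ∀ Q, push pairXU Q ∈ N → push (fun q => q.2.1) Q = QY →
        Q ∉ badSet P d R Δ L (R ≤ kappa₂ P QX W) φ) ?_ ?_ ?_ ?_
  · exact ⟨Set.univ, Filter.univ_mem, by simp⟩
  · rintro s t hst ⟨N, hN, ht⟩
    exact ⟨N, hN, fun QY hQY => ht QY (hst hQY)⟩
  · rintro s t ⟨N, hN, hs⟩ ⟨N', hN', ht⟩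
    refine ⟨N ∩ N', Filter.inter_mem hN hN', fun QY hQY => ?_⟩
    rcases hQY with hQY | hQY
    · obtain ⟨φ, hφ⟩ := hs QY hQY
      exact ⟨φ, fun Q hQ => hφ Q hQ.1⟩
    · obtain ⟨φ, hφ⟩ := ht QY hQY
      exact ⟨φ, fun Q hQ => hφ Q hQ.2⟩
  · intro QY hQY
    obtain ⟨φ, hφ⟩ := h QY hQY
    -- The pairs of marginals of bad distributions form a compact set missing `(Q_X W, Q_Y)`, so a
    -- product neighbourhood of that point misses it too, with the same `φ`.
    have hcl : IsClosed ((fun Q => (push pairXU Q, push (fun q : X × Y × Fin m => q.2.1) Q)) ''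
        badSet P d R Δ L (R ≤ kappa₂ P QX W) φ) :=
      ((isCompact_badSet P d R Δ L _ φ).image (by fun_prop)).isClosed
    have hnot : (joint QX W, QY) ∉
        (fun Q => (push pairXU Q, push (fun q : X × Y × Fin m => q.2.1) Q)) ''
        badSet P d R Δ L (R ≤ kappa₂ P QX W) φ := by
      rintro ⟨Q, hQ, hQe⟩
      have hc : Q ∈ couplings QX W QY :=
        mem_couplings_iff.2 ⟨hQ.1, congrArg Prod.fst hQe, congrArg Prod.snd hQe⟩
      exact notMem_badSet hW hc (hφ Q hc) hQ
    have hmem := hcl.isOpen_compl.mem_nhds hnot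
    rw [nhds_prod_eq, Filter.mem_prod_iff] at hmem
    obtain ⟨N, hN, T, hT, hNT⟩ := hmem
    refine ⟨T, mem_nhdsWithin_of_mem_nhds hT, N, hN, fun QY' hQY' => ⟨φ, fun Q hQN hQY hbad => ?_⟩⟩
    exact hNT (Set.mk_mem_prod hQN (hQY ▸ hQY') : (push pairXU Q, push (fun q => q.2.1) Q) ∈ _)
      ⟨Q, hbad, rfl⟩

/-- Conditioning `J` on its first coordinate gives a channel admitted in `κ(G, Q)`, with conditional
entropy `H(J) - H(Q)`. Rows at letters of mass zero are set to the identity, which is always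
admitted. -/
theorem ent_sub_le_kappa {G : SimpleGraph A} {Q : A → ℝ} {J : A × A → ℝ}
    (hJ : J ∈ stdSimplex ℝ (A × A)) (hG : ∀ a b, ¬(a = b ∨ G.Adj a b) → J (a, b) = 0)
    (h1 : push Prod.fst J = Q) (h2 : push Prod.snd J = Q) : ent J - ent Q ≤ kappa G Q := by
  have hQ : Q ∈ stdSimplex ℝ A := h1 ▸ push_mem_stdSimplex hJ _
  set V : A → A → ℝ := fun a b => if Q a = 0 then (if a = b then 1 else 0) else J (a, b) / Q a
    with hVdef
  have hV : IsChannel V := by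
    intro a
    by_cases ha : Q a = 0
    · have : V a = Pi.single a 1 := by
        funext b
        simp [hVdef, ha, Pi.single_apply, eq_comm]
      rw [this]
      exact single_mem_stdSimplex ℝ a
    · simp only [hVdef, ha, if_false]
      refine ⟨fun b => div_nonneg (hJ.1 _) (hQ.1 a), ?_⟩
      rw [← Finset.sum_div, ← push_fst_apply, h1, div_self ha]
  have hjoint : joint Q V = J := by
    funext p
    simp only [joint, hVdef]
    by_cases ha : Q p.1 = 0
    · have h3 := le_push (g := Prod.fst) hJ.1 p
      rw [h1, ha] at h3
      rw [ha, zero_mul, le_antisymm h3 (hJ.1 p)]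
    · rw [if_neg ha]
      field_simp
  have hmem : V ∈ kappaChannels G Q := by
    refine ⟨hV, fun a b hab => ?_, fun b => ?_⟩
    · simp only [hVdef]
      split_ifs with h3 h4
      · exact absurd (Or.inl h4) hab
      · rfl
      · rw [hG a b hab, zero_div]
    · have := push_snd_apply (joint Q V) b
      rw [hjoint, h2, ← hjoint] at this
      exact this.symm
  have h4 := ent_joint (Q := Q) hV
  rw [hjoint] at h4
  have h5 := (kappa_isGreatest G Q).2 (Set.mem_image_of_mem _ hmem)
  linarith

/-- Upper semicontinuity of `κ` by compactness: the couplings on `G` exceeding the bound by `δ` have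
a closed set of marginal pairs, which does not contain `(Q, Q)`. -/
theorem exists_nhds_kappa {G : SimpleGraph A} {Q : A → ℝ} {δ : ℝ} (hδ : 0 < δ) :
    ∃ N ∈ 𝓝 Q, ∀ J ∈ stdSimplex ℝ (A × A), (∀ a b, ¬(a = b ∨ G.Adj a b) → J (a, b) = 0) →
      push Prod.fst J ∈ N → push Prod.snd J ∈ N → ent J - ent (push Prod.fst J) ≤ kappa G Q + δ := by
  set S : Set (A × A → ℝ) := {J | J ∈ stdSimplex ℝ (A × A) ∧
    (∀ a b, ¬(a = b ∨ G.Adj a b) → J (a, b) = 0) ∧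
    kappa G Q + δ ≤ ent J - ent (push Prod.fst J)} with hS
  have hScomp : IsCompact S := by
    have h1 : IsClosed {J : A × A → ℝ | ∀ a b, ¬(a = b ∨ G.Adj a b) → J (a, b) = 0} := by
      simp only [Set.ofPred_forall]
      exact isClosed_iInter fun a => isClosed_iInter fun b => isClosed_iInter fun _ =>
        isClosed_eq (by fun_prop) continuous_const
    have h2 : IsClosed {J : A × A → ℝ | kappa G Q + δ ≤ ent J - ent (push Prod.fst J)} :=
      isClosed_le continuous_const (by fun_prop)
    exact (isCompact_stdSimplex ℝ (A × A)).inter_right (h1.inter h2)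
  have hcl : IsClosed ((fun J => (push Prod.fst J, push (Prod.snd : A × A → A) J)) '' S) :=
    (hScomp.image (by fun_prop)).isClosed
  have hnot : (Q, Q) ∉ (fun J => (push Prod.fst J, push (Prod.snd : A × A → A) J)) '' S := by
    rintro ⟨J, ⟨hJ, hG, hle⟩, hJe⟩
    have h1 : push Prod.fst J = Q := congrArg Prod.fst hJe
    have h2 := ent_sub_le_kappa hJ hG h1 (congrArg Prod.snd hJe)
    rw [h1] at hle
    linarith
  have hmem := hcl.isOpen_compl.mem_nhds hnot
  rw [nhds_prod_eq, Filter.mem_prod_iff] at hmem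
  obtain ⟨N, hN, T, hT, hNT⟩ := hmem
  refine ⟨N ∩ T, Filter.inter_mem hN hT, fun J hJ hG h1 h2 => ?_⟩
  by_contra! hlt
  exact hNT (Set.mk_mem_prod h1.1 h2.2 : (push Prod.fst J, push Prod.snd J) ∈ _)
    ⟨J, ⟨hJ, hG, hlt.le⟩, rfl⟩

/-- An admitted channel preserves `Q`, so its conditional entropy is at most the entropy of its
output `Q`. -/
theorem kappa_le_ent (G : SimpleGraph A) {Q : A → ℝ} (hQ : Q ∈ stdSimplex ℝ A) :
    kappa G Q ≤ ent Q := by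
  obtain ⟨V, hV, hVe⟩ := (kappa_isGreatest G Q).1
  have h : push Prod.snd (joint Q V) = Q := by
    funext b
    rw [push_snd_apply]
    exact hV.2.2 b
  have := condEntropy_le_ent hQ hV.1
  rwa [h, hVe] at this

/-- `κ₂` does not exceed the mutual information of the test channel. -/
theorem kappa₂_le {P : X × Y → ℝ} {QX : X → ℝ} (hQX : QX ∈ stdSimplex ℝ X) {W : X → U → ℝ}
    (hW : IsChannel W) :
    kappa₂ P QX W ≤ ent (push Prod.snd (joint QX W)) - condEntropy QX W := by
  have h : (fun u => ∑ x, QX x * W x u) = push Prod.snd (joint QX W) :=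
    funext fun u => (push_snd_apply (joint QX W) u).symm
  rw [kappa₂, h]
  have h1 := condEntropy_le_ent hQX hW
  have h2 := kappa_le_ent (charGraph (inducedUY P W))
    (push_mem_stdSimplex (joint_mem_stdSimplex hQX hW) Prod.snd)
  exact max_le (by linarith) (by linarith)

theorem infoXU_of_mem_couplings {m : ℕ} {QX : X → ℝ} {W : X → Fin m → ℝ} {QY : Y → ℝ}
    (hW : IsChannel W) {Q : X × Y × Fin m → ℝ} (hQ : Q ∈ couplings QX W QY) :
    infoXU Q = ent (push Prod.snd (joint QX W)) - condEntropy QX W := by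
  obtain ⟨-, hXU, -⟩ := mem_couplings_iff.1 hQ
  have hX : push Prod.fst Q = QX := by
    rw [← push_fst_joint hW QX, ← hXU, push_push]
    rfl
  have hU : push (fun q => q.2.2) Q = push Prod.snd (joint QX W) := by
    rw [← hXU, push_push]
    rfl
  rw [infoXU, hX, hU, hXU, ent_joint hW]
  ring

/-- Since `κ₂ ≤ I(X;U)`, the second case of `eta` is contained in that of `etaD`; where they differ,
`eta` is infinite. -/
theorem etaD_le_eta {m : ℕ} {P : X × Y → ℝ} {d : X → Z → ℝ} {R Δ : ℝ} {QX : X → ℝ}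
    {W : X → Fin m → ℝ} {QY : Y → ℝ} (hQX : QX ∈ stdSimplex ℝ X) (hW : IsChannel W)
    {Q : X × Y × Fin m → ℝ} (hQ : Q ∈ couplings QX W QY) (φ : Y → Fin m → Z) :
    etaD R Δ P d W φ Q ≤ eta R Δ P d W φ Q := by
  rw [eta, etaD, objective, objective, sum_eq_of_mem_couplings hW hQ]
  have h1 : kappa₂ P QX W ≤ mutualInfo fun p : X × Fin m => ∑ y, Q (p.1, y, p.2) := by
    rw [mutualInfo_XU_eq hQ.1.1, infoXU_of_mem_couplings hW hQ]
    exact kappa₂_le hQX hW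
  split_ifs with h2 h3 h4 h4
  · exact le_rfl
  · exact le_rfl
  · exact le_top
  · exact absurd (h4.trans h1) h3
  · exact le_rfl

theorem infSup_etaD_le (P : X × Y → ℝ) (d : X → Z → ℝ) (R Δ : ℝ) :
    infSup (fun W φ Q => etaD R Δ P d W φ Q) ≤ infSup (fun W φ Q => eta R Δ P d W φ Q) := by
  unfold infSup
  exact iInf₂_mono fun QX hQX => iSup_mono fun m => iSup₂_mono fun W hW => iInf₂_mono fun QY _ =>
    iSup_mono fun φ => iInf₂_mono fun Q hQ => etaD_le_eta hQX hW hQ φ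

end SingleLetter

/-! ### Probabilities of joint types, and greedy colouring -/

section Counting

open scoped Classical

set_option linter.unusedSectionVars false

variable {A B X Y U : Type*} [Fintype A] [Fintype B] [Fintype X] [Fintype Y] [Fintype U]

theorem push_equiv_apply (e : A ≃ B) (Q : A → ℝ) (b : B) : push e Q b = Q (e.symm b) := by
  simp only [push]
  rw [Finset.sum_eq_single (e.symm b)]
  · simp
  · intro a _ ha
    refine if_neg fun h => ha ?_
    rw [← h, e.symm_apply_apply]
  · simp

theorem ent_push_equiv (e : A ≃ B) (Q : A → ℝ) : ent (push e Q) = ent Q := by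
  simp only [ent, push_equiv_apply]
  exact Equiv.sum_comp e.symm fun a => -(Q a * Real.logb 2 (Q a))

theorem ent_emp_swap {n : ℕ} (s : Fin n → A) (t : Fin n → B) :
    ent (emp fun i => (s i, t i)) = ent (emp fun i => (t i, s i)) := by
  rw [← ent_push_equiv (Equiv.prodComm A B), push_emp]
  rfl

theorem eventually_pow_le_two_rpow (k : ℕ) {δ : ℝ} (hδ : 0 < δ) :
    ∀ᶠ n : ℕ in Filter.atTop, ((n : ℝ) + 1) ^ k ≤ 2 ^ (n * δ) := by
  have hr : (1 : ℝ) < 2 ^ δ := Real.one_lt_rpow one_lt_two hδ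
  have h1 := tendsto_pow_const_div_const_pow_of_one_lt k hr
  have h2 := ((h1.comp (Filter.tendsto_add_atTop_nat 1)).mul_const ((2 : ℝ) ^ δ))
  rw [zero_mul] at h2
  filter_upwards [h2.eventually_le_const (by norm_num : (0 : ℝ) < 1)] with n hn
  simp only [Function.comp_apply, Nat.cast_add, Nat.cast_one, pow_succ] at hn
  have h3 : (2 : ℝ) ^ (n * δ) = (2 ^ δ) ^ n := by
    rw [mul_comm, Real.rpow_mul_natCast two_pos.le]
  rw [h3]
  have h4 : (0 : ℝ) < 2 ^ δ := by positivity
  rw [← div_le_one (by positivity)]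
  calc _ = ((n : ℝ) + 1) ^ k / ((2 ^ δ) ^ n * 2 ^ δ) * 2 ^ δ := by field_simp
    _ ≤ 1 := hn

theorem eventually_const_le_two_rpow (C : ℝ) {δ : ℝ} (hδ : 0 < δ) :
    ∀ᶠ n : ℕ in Filter.atTop, C ≤ 2 ^ (n * δ) := by
  filter_upwards [eventually_pow_le_two_rpow 1 hδ,
    tendsto_natCast_atTop_atTop.eventually_ge_atTop C] with n h1 h2
  linarith

/-- Doubly exponential decay survives a union bound over exponentially many words. -/
theorem eventually_mul_exp_neg_two_rpow_le (a K : ℝ) {δ : ℝ} (hδ : 0 < δ) (ha : 0 < a) :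
    ∀ᶠ n : ℕ in Filter.atTop, a ^ n * Real.exp (-(2 : ℝ) ^ (n * δ)) ≤ 2 ^ (-(n * K)) := by
  filter_upwards [eventually_pow_le_two_rpow 2 hδ,
    tendsto_natCast_atTop_atTop.eventually_ge_atTop (Real.log a + K * Real.log 2)] with n h1 h2
  rw [← Real.exp_log (pow_pos ha n), ← Real.exp_add, Real.log_pow,
    Real.rpow_def_of_pos two_pos (-(n * K))]
  refine Real.exp_le_exp.2 ?_
  have hn : (0 : ℝ) ≤ n := n.cast_nonneg
  nlinarith

/-- For any assignment of descriptions, the probability that the joint type is `Q`. -/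
theorem sum_type_le {n : ℕ} (hn : 0 < n) {P : X × Y → ℝ} (hP : ∀ p, 0 ≤ P p)
    (c : (Fin n → X) → Fin n → U) (Q : X × Y × U → ℝ) :
    ∑ x : Fin n → X, ∑ y : Fin n → Y,
      (if emp (fun i => (x i, y i, c x i)) = Q then ∏ i, P (x i, y i) else 0) ≤
        2 ^ (-(n * divEnt P Q)) := by
  set T := ∑ q, Q q * Real.logb 2 (P (q.1, q.2.1)) with hT
  set h := ent Q - ent (push pairXU Q) with hh
  have h1 : ∀ (x : Fin n → X) (y : Fin n → Y),
      (if emp (fun i => (x i, y i, c x i)) = Q then ∏ i, P (x i, y i) else 0) ≤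
      if emp (fun i => (x i, y i, c x i)) = Q then (2 : ℝ) ^ (n * T) else 0 := by
    intro x y
    split_ifs with hE
    · by_cases hpos : ∀ i, 0 < P (x i, y i)
      · rw [prod_eq_rpow hn (fun i => (x i, y i, c x i)) (w := fun q => P (q.1, q.2.1)) hpos, hE]
      · push Not at hpos
        obtain ⟨i, hi⟩ := hpos
        rw [Finset.prod_eq_zero (Finset.mem_univ i) (le_antisymm hi (hP _))]
        positivity
    · exact le_rfl
  let e : X × Y × U ≃ Y × (X × U) :=
    ⟨fun q => (q.2.1, (q.1, q.2.2)), fun q => (q.2.1, (q.1, q.2.2)), fun _ => rfl, fun _ => rfl⟩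
  -- The description is a function of `x`, so given `x` only the words `y` are counted,
  -- conditionally on the pair `(x, c x)`.
  have h2 : ∀ x : Fin n → X, ∑ y : Fin n → Y,
      (if emp (fun i => (x i, y i, c x i)) = Q then (2 : ℝ) ^ (n * T) else 0) ≤
      if emp x = push Prod.fst Q then (2 : ℝ) ^ (n * h) * 2 ^ (n * T) else 0 := by
    intro x
    by_cases hx : emp x = push Prod.fst Q
    · rw [if_pos hx, ← Finset.sum_filter, Finset.sum_const, nsmul_eq_mul]
      refine mul_le_mul_of_nonneg_right ?_ (by positivity)
      have h3 := card_cond_type_le hn (fun i => (x i, c x i)) (push e Q)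
      rw [ent_push_equiv, push_push] at h3
      refine le_trans ?_ h3
      refine Nat.cast_le.2 (Finset.card_le_card fun y hy => ?_)
      rw [Finset.mem_filter] at hy ⊢
      refine ⟨Finset.mem_univ _, ?_⟩
      rw [← hy.2, push_emp]
      rfl
    · rw [if_neg hx]
      refine (Finset.sum_eq_zero fun y _ => if_neg fun hE => hx ?_).le
      rw [← hE, push_emp]
      rfl
  calc _ ≤ ∑ x : Fin n → X, ∑ y : Fin n → Y,
        (if emp (fun i => (x i, y i, c x i)) = Q then (2 : ℝ) ^ (n * T) else 0) :=
        Finset.sum_le_sum fun x _ => Finset.sum_le_sum fun y _ => h1 x y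
    _ ≤ ∑ x : Fin n → X, if emp x = push Prod.fst Q then (2 : ℝ) ^ (n * h) * 2 ^ (n * T) else 0 :=
        Finset.sum_le_sum fun x _ => h2 x
    _ ≤ 2 ^ (n * ent (push Prod.fst Q)) * (2 ^ (n * h) * 2 ^ (n * T)) := by
        rw [← Finset.sum_filter, Finset.sum_const, nsmul_eq_mul]
        exact mul_le_mul_of_nonneg_right (card_type_le hn _) (by positivity)
    _ = _ := by
        rw [← Real.rpow_add two_pos, ← Real.rpow_add two_pos]
        congr 1
        simp only [divEnt, hh, hT]
        ring

/-- The probability that an independent description has joint type `Q` with source and side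
information. -/
theorem sum_indep_type_le {n : ℕ} (hn : 0 < n) {P : X × Y → ℝ} (hP : ∀ p, 0 ≤ P p)
    {G : U → ℝ} (hG : ∀ b, 0 < G b) (Q : X × Y × U → ℝ) :
    ∑ x : Fin n → X, ∑ y : Fin n → Y, (∏ i, P (x i, y i)) * ∑ u : Fin n → U, iidWeight G u *
      (if emp (fun i => (x i, y i, u i)) = Q then 1 else 0) ≤
        2 ^ (n * (ent Q + ∑ q, Q q * Real.logb 2 (P (q.1, q.2.1)) +
          ∑ b, push (fun q => q.2.2) Q b * Real.logb 2 (G b))) := by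
  set T := ∑ q, Q q * Real.logb 2 (P (q.1, q.2.1)) +
    ∑ b, push (fun q => q.2.2) Q b * Real.logb 2 (G b) with hT
  have h1 : ∀ (x : Fin n → X) (y : Fin n → Y) (u : Fin n → U), (∏ i, P (x i, y i)) *
      (iidWeight G u * (if emp (fun i => (x i, y i, u i)) = Q then 1 else 0)) ≤
      if emp (fun i => (x i, y i, u i)) = Q then (2 : ℝ) ^ (n * T) else 0 := by
    intro x y u
    split_ifs with hE
    · by_cases hpos : ∀ i, 0 < P (x i, y i)
      · rw [prod_eq_rpow hn (fun i => (x i, y i, u i)) (w := fun q => P (q.1, q.2.1)) hpos, hE,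
          iidWeight, prod_eq_rpow hn u fun i => hG _, mul_one, ← Real.rpow_add two_pos,
          hT, mul_add, ← hE, push_emp]
        rfl
      · push Not at hpos
        obtain ⟨i, hi⟩ := hpos
        rw [Finset.prod_eq_zero (Finset.mem_univ i) (le_antisymm hi (hP _)), zero_mul]
        positivity
    · simp
  let e : (Fin n → X) × (Fin n → Y) × (Fin n → U) ≃ (Fin n → X × Y × U) :=
    ⟨fun p i => (p.1 i, p.2.1 i, p.2.2 i),
      fun z => (fun i => (z i).1, fun i => (z i).2.1, fun i => (z i).2.2),
      fun _ => rfl, fun _ => rfl⟩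
  calc _ ≤ ∑ x : Fin n → X, ∑ y : Fin n → Y, ∑ u : Fin n → U,
        if emp (fun i => (x i, y i, u i)) = Q then (2 : ℝ) ^ (n * T) else 0 := by
        simp only [Finset.mul_sum]
        exact Finset.sum_le_sum fun x _ => Finset.sum_le_sum fun y _ =>
          Finset.sum_le_sum fun u _ => h1 x y u
    _ = ∑ z : Fin n → X × Y × U, if emp z = Q then (2 : ℝ) ^ (n * T) else 0 := by
        rw [← Equiv.sum_comp e, Fintype.sum_prod_type]
        refine Finset.sum_congr rfl fun x _ => ?_
        rw [Fintype.sum_prod_type]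
        rfl
    _ ≤ 2 ^ (n * ent Q) * 2 ^ (n * T) := by
        rw [← Finset.sum_filter, Finset.sum_const, nsmul_eq_mul]
        exact mul_le_mul_of_nonneg_right (card_type_le hn _) (by positivity)
    _ = _ := by
        rw [← Real.rpow_add two_pos, hT]
        congr 1
        ring

/-- The probability that a random word has small empirical conditional entropy given `s`. -/
theorem sum_small_entropy_le {n : ℕ} (hn : 0 < n) {G : U → ℝ} {S : (Fin n → U) → Prop} {η h : ℝ}
    (hS : ∀ u : Fin n → U, S u → iidWeight G u ≤ 2 ^ (-(n * η))) (s : Fin n → B)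
    (hh : ∀ u, S u → ent (emp fun i => (u i, s i)) - ent (emp s) ≤ h) :
    ∑ u : Fin n → U, iidWeight G u * (if S u then 1 else 0) ≤
      ((n : ℝ) + 1) ^ Fintype.card (U × B) * 2 ^ (n * (h - η)) := by
  have h1 : ((Finset.univ.filter S).card : ℝ) ≤
      ((n : ℝ) + 1) ^ Fintype.card (U × B) * 2 ^ (n * h) := by
    set T := (types (U × B) n).filter fun N => ent N - ent (push Prod.snd N) ≤ h with hT
    have hsub : Finset.univ.filter S ⊆
        T.biUnion fun N => Finset.univ.filter fun u => emp (fun i => (u i, s i)) = N := by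
      intro u hu
      have hu' := (Finset.mem_filter.1 hu).2
      refine Finset.mem_biUnion.2 ⟨emp fun i => (u i, s i), Finset.mem_filter.2
        ⟨emp_mem_types _, ?_⟩, Finset.mem_filter.2 ⟨Finset.mem_univ _, rfl⟩⟩
      rw [push_emp]
      exact hh u hu'
    calc ((Finset.univ.filter S).card : ℝ) ≤ ∑ N ∈ T,
          ((Finset.univ.filter fun u : Fin n → U => emp (fun i => (u i, s i)) = N).card : ℝ) := by
          exact_mod_cast (Finset.card_le_card hsub).trans Finset.card_biUnion_le
      _ ≤ ∑ _N ∈ T, (2 : ℝ) ^ (n * h) := by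
          refine Finset.sum_le_sum fun N hN => (card_cond_type_le hn s N).trans ?_
          refine Real.rpow_le_rpow_of_exponent_le one_le_two ?_
          exact mul_le_mul_of_nonneg_left (Finset.mem_filter.1 hN).2 n.cast_nonneg
      _ ≤ _ := by
          rw [Finset.sum_const, nsmul_eq_mul]
          refine mul_le_mul_of_nonneg_right ?_ (by positivity)
          exact_mod_cast (Finset.card_filter_le _ _).trans (card_types_le n)
  calc _ ≤ ∑ u : Fin n → U, if S u then (2 : ℝ) ^ (-(n * η)) else 0 := by
        refine Finset.sum_le_sum fun u _ => ?_
        split_ifs with hu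
        · rw [mul_one]
          exact hS u hu
        · simp
    _ ≤ ((n : ℝ) + 1) ^ Fintype.card (U × B) * 2 ^ (n * h) * 2 ^ (-(n * η)) := by
        rw [← Finset.sum_filter, Finset.sum_const, nsmul_eq_mul]
        exact mul_le_mul_of_nonneg_right h1 (by positivity)
    _ = _ := by
        rw [mul_assoc, ← Real.rpow_add two_pos]
        congr 2
        ring

/-- Vertices are coloured one at a time; fewer than `t` colours are forbidden at each. -/
theorem exists_greedy_coloring {ι : Type*} [Fintype ι] {r : ι → ι → Prop}
    (hr : ∀ i j, r i j → r j i) {t : ℕ} (h : ∀ i, (Finset.univ.filter fun j => r i j).card < t) :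
    ∃ col : ι → Fin t, ∀ i j, i ≠ j → r i j → col i ≠ col j := by
  by_cases hι : IsEmpty ι
  · exact ⟨fun i => hι.elim i, fun i => hι.elim i⟩
  obtain ⟨i₀⟩ := not_isEmpty_iff.1 hι
  have ht : 0 < t := (Nat.zero_le _).trans_lt (h i₀)
  suffices H : ∀ s : Finset ι, ∃ col : ι → Fin t, ∀ i ∈ s, ∀ j ∈ s, i ≠ j → r i j →
      col i ≠ col j by
    obtain ⟨col, hcol⟩ := H Finset.univ
    exact ⟨col, fun i j => hcol i (Finset.mem_univ i) j (Finset.mem_univ j)⟩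
  intro s
  induction s using Finset.induction_on with
  | empty => exact ⟨fun _ => ⟨0, ht⟩, by simp⟩
  | insert a s ha ih =>
    obtain ⟨col, hcol⟩ := ih
    obtain ⟨k, hk⟩ : ∃ k, k ∉ (Finset.univ.filter fun j => r a j).image col := by
      by_contra! hall
      have h1 : (Finset.univ : Finset (Fin t)).card ≤
          ((Finset.univ.filter fun j => r a j).image col).card :=
        Finset.card_le_card fun k _ => hall k
      rw [Finset.card_univ, Fintype.card_fin] at h1
      exact absurd (h1.trans Finset.card_image_le) (not_le.2 (h a))
    have hk' : ∀ j, r a j → col j ≠ k := fun j hj he =>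
      hk (Finset.mem_image.2 ⟨j, Finset.mem_filter.2 ⟨Finset.mem_univ _, hj⟩, he⟩)
    refine ⟨Function.update col a k, fun i hi j hj hij hrij => ?_⟩
    rcases Finset.mem_insert.1 hi with rfl | hi'
    · rw [Function.update_self, Function.update_of_ne hij.symm]
      exact (hk' j hrij).symm
    · have hia : i ≠ a := fun h => ha (h ▸ hi')
      rcases Finset.mem_insert.1 hj with rfl | hj'
      · rw [Function.update_self, Function.update_of_ne hij]
        exact hk' i (hr _ _ hrij)
      · have hja : j ≠ a := fun h => ha (h ▸ hj')
        rw [Function.update_of_ne hia, Function.update_of_ne hja]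
        exact hcol i hi' j hj' hij hrij

end Counting

/-! ### Codebooks and error-free recovery of the description -/

section ZeroError

open scoped Classical

set_option linter.unusedSectionVars false

variable {X Y Z U : Type*} [Fintype X] [Fintype Y] [Fintype U]

/-- A code of rate `r` and block length `n` whose error probability on source words with type in `Ω`
is at most `2 ^ (-n L)`. -/
def HasRegionCode (P : X × Y → ℝ) (d : X → Z → ℝ) (Δ r L : ℝ) (Ω : Set (X → ℝ)) (n : ℕ) : Prop :=
  ∃ (k : ℕ) (f : (Fin n → X) → Fin k) (g : Fin k → (Fin n → Y) → Fin n → Z),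
    (k : ℝ) ≤ 2 ^ (n * r) ∧
    ∑ x : Fin n → X, ∑ y : Fin n → Y, (if emp x ∈ Ω ∧ Δ < (∑ i, d (x i) (g (f x) y i)) / n then
      ∏ i, P (x i, y i) else 0) ≤ 2 ^ (-(n * L))

/-- The mutual information between input and output of a channel. -/
def chanInfo (QX : X → ℝ) (W : X → U → ℝ) : ℝ :=
  ent (push Prod.snd (joint QX W)) - condEntropy QX W

theorem chanInfo_nonneg {QX : X → ℝ} (hQX : QX ∈ stdSimplex ℝ X) {W : X → U → ℝ}
    (hW : IsChannel W) : 0 ≤ chanInfo QX W :=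
  sub_nonneg.2 (condEntropy_le_ent hQX hW)

/-- A codeword law adapted to a test channel. -/
theorem exists_codeword_law [Nonempty U] {QX : X → ℝ} (hQX : QX ∈ stdSimplex ℝ X)
    {W : X → U → ℝ} (hW : IsChannel W) {δ : ℝ} (hδ : 0 < δ) :
    ∃ G ∈ stdSimplex ℝ U, (∀ b, 0 < G b) ∧
      (∃ NU ∈ 𝓝 (push Prod.snd (joint QX W)), ∀ n : ℕ, 0 < n → ∀ u : Fin n → U, emp u ∈ NU →
        iidWeight G u ≤ 2 ^ (-(n * (ent (push Prod.snd (joint QX W)) - δ)))) ∧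
      ∀ N ∈ 𝓝 (joint QX W), ∃ Ω ∈ 𝓝 QX, ∀ᶠ n : ℕ in Filter.atTop, ∀ x : Fin n → X, emp x ∈ Ω →
        (2 : ℝ) ^ (-(n * (chanInfo QX W + 2 * δ))) ≤
          ∑ u : Fin n → U, iidWeight G u * if Admissible W N x u then 1 else 0 := by
  set QU := push Prod.snd (joint QX W) with hQU
  have hQUs : QU ∈ stdSimplex ℝ U := push_mem_stdSimplex (joint_mem_stdSimplex hQX hW) _
  obtain ⟨G, hG, hGpos, hGle⟩ := exists_pos_cross_le hQUs hδ
  have hgibbs := ent_le_cross hQUs hG fun a h => absurd h (hGpos a).ne'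
  -- The types whose cross entropy against `G` exceeds `H(Q_U) - δ`; this set is open, and contains
  -- `Q_U` by Gibbs' inequality.
  refine ⟨G, hG, hGpos, ⟨{E | ent QU - δ < -∑ b, E b * Real.logb 2 (G b)}, ?_, ?_⟩, ?_⟩
  · refine (isOpen_lt continuous_const (by fun_prop)).mem_nhds ?_
    change ent QU - δ < -∑ b, QU b * Real.logb 2 (G b)
    linarith
  · intro n hn u hu
    have hu' : ent QU - δ < -∑ b, emp u b * Real.logb 2 (G b) := hu
    rw [iidWeight, prod_eq_rpow hn u fun i => hGpos _]
    refine Real.rpow_le_rpow_of_exponent_le one_le_two ?_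
    rw [← mul_neg]
    exact mul_le_mul_of_nonneg_left (by linarith) n.cast_nonneg
  · intro N hN
    exact exists_nhds_admissible hW QX hN hGpos (by rw [chanInfo]; linarith)

theorem sum_div_eq_sum_emp_mul {A : Type*} [Fintype A] {n : ℕ} (hn : 0 < n) (z : Fin n → A)
    (f : A → ℝ) : (∑ i, f (z i)) / n = ∑ a, emp z a * f a := by
  have hn' : (n : ℝ) ≠ 0 := by positivity
  rw [← sum_emp_mul hn, mul_div_cancel_left₀ _ hn']

theorem emp_eq_zero_of_dominated {n : ℕ} {P : X × Y → ℝ} {x : Fin n → X} {y : Fin n → Y}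
    (hP : ∏ i, P (x i, y i) ≠ 0) (u : Fin n → U) (q : X × Y × U) (hq : P (q.1, q.2.1) = 0) :
    emp (fun i => (x i, y i, u i)) q = 0 := by
  by_contra hne
  obtain ⟨i, rfl⟩ := exists_of_emp_ne_zero hne
  exact hP (Finset.prod_eq_zero (Finset.mem_univ i) hq)

/-- A pair of positive probability has a joint type supported where `P` is, so avoiding the bad set
can only mean that the exponent exceeds `L`. -/
theorem lt_of_emp_notMem_badSet {n : ℕ} (hn : 0 < n) {P : X × Y → ℝ} {d : X → Z → ℝ}
    {R Δ L : ℝ} {b : Prop} {φ : Y → U → Z} {x : Fin n → X} {y : Fin n → Y} {u : Fin n → U}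
    (hP : ∏ i, P (x i, y i) ≠ 0)
    (hbad : emp (fun i => (x i, y i, u i)) ∉ badSet P d R Δ L b φ) :
    (Δ < (∑ i, d (x i) (φ (y i) (u i))) / n → L < divEnt P (emp fun i => (x i, y i, u i))) ∧
    (b → L < divEnt P (emp fun i => (x i, y i, u i)) +
      max 0 (R - infoXU (emp fun i => (x i, y i, u i)) +
        infoYU (emp fun i => (x i, y i, u i)))) := by
  set Q := emp fun i => (x i, y i, u i) with hQ
  have h1 : Q ∈ stdSimplex ℝ (X × Y × U) := emp_mem_stdSimplex hn _
  have h2 : ∀ q, P (q.1, q.2.1) = 0 → Q q = 0 := emp_eq_zero_of_dominated hP u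
  constructor
  · intro hd
    by_contra! hle
    refine hbad ⟨h1, h2, Or.inl ⟨?_, hle⟩⟩
    rw [sum_div_eq_sum_emp_mul hn (fun i => (x i, y i, u i))
      fun q : X × Y × U => d q.1 (φ q.2.1 q.2.2)] at hd
    exact hd.le
  · intro hb
    by_contra! hle
    exact hbad ⟨h1, h2, Or.inr ⟨hb, hle⟩⟩

/-- Sums `sum_type_le` over polynomially many types. No assumption on the choice of description is
needed. -/
theorem sum_types_large_le {n : ℕ} (hn : 0 < n) {P : X × Y → ℝ} (hP : ∀ p, 0 ≤ P p) (L : ℝ)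
    (c : (Fin n → X) → Fin n → U) :
    ∑ x : Fin n → X, ∑ y : Fin n → Y,
      ∑ Q ∈ (types (X × Y × U) n).filter fun Q => L < divEnt P Q,
        (if emp (fun i => (x i, y i, c x i)) = Q then ∏ i, P (x i, y i) else 0) ≤
      ((n : ℝ) + 1) ^ Fintype.card (X × Y × U) * 2 ^ (-(n * L)) := by
  calc _ = ∑ Q ∈ (types (X × Y × U) n).filter fun Q => L < divEnt P Q,
        ∑ x : Fin n → X, ∑ y : Fin n → Y,
          (if emp (fun i => (x i, y i, c x i)) = Q then ∏ i, P (x i, y i) else 0) := by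
        rw [Finset.sum_comm]
        rw [Finset.sum_congr rfl fun x _ => Finset.sum_comm]
        rw [Finset.sum_comm]
        exact Finset.sum_congr rfl fun Q _ => Finset.sum_comm
    _ ≤ ∑ _Q ∈ (types (X × Y × U) n).filter fun Q => L < divEnt P Q, (2 : ℝ) ^ (-(n * L)) := by
        refine Finset.sum_le_sum fun Q hQ => (sum_type_le hn hP c Q).trans ?_
        refine Real.rpow_le_rpow_of_exponent_le one_le_two (neg_le_neg ?_)
        exact mul_le_mul_of_nonneg_left (Finset.mem_filter.1 hQ).2.le n.cast_nonneg
    _ ≤ _ := by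
        rw [Finset.sum_const, nsmul_eq_mul]
        refine mul_le_mul_of_nonneg_right ?_ (by positivity)
        exact_mod_cast (Finset.card_filter_le _ _).trans (card_types_le n)

/-- Words that are confusable at the decoder. -/
def Confusable (G : SimpleGraph U) (NU : Set (U → ℝ)) {n : ℕ} (v w : Fin n → U) : Prop :=
  emp v ∈ NU ∧ emp w ∈ NU ∧ ∀ i, v i = w i ∨ G.Adj (v i) (w i)

theorem Confusable.symm {G : SimpleGraph U} {NU : Set (U → ℝ)} {n : ℕ} {v w : Fin n → U}
    (h : Confusable G NU v w) : Confusable G NU w v :=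
  ⟨h.2.1, h.1, fun i => (h.2.2 i).imp Eq.symm fun h => h.symm⟩

/-- The joint type of a confusable pair lives on `G` with both marginals in `NU`, so its conditional
entropy is at most `κ + δ`; each such word has weight at most `2 ^ (-n η)`. -/
theorem confusable_weight_le {n : ℕ} (hn : 0 < n) {G : SimpleGraph U} {NU : Set (U → ℝ)}
    {QU g : U → ℝ} {δ η : ℝ}
    (hNU : ∀ J ∈ stdSimplex ℝ (U × U), (∀ a b, ¬(a = b ∨ G.Adj a b) → J (a, b) = 0) →
      push Prod.fst J ∈ NU → push Prod.snd J ∈ NU →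
        ent J - ent (push Prod.fst J) ≤ kappa G QU + δ)
    (hg : ∀ u : Fin n → U, emp u ∈ NU → iidWeight g u ≤ 2 ^ (-(n * η))) (v : Fin n → U) :
    ∑ w : Fin n → U, iidWeight g w * (if Confusable G NU v w then 1 else 0) ≤
      ((n : ℝ) + 1) ^ Fintype.card (U × U) * 2 ^ (n * (kappa G QU + δ - η)) := by
  refine sum_small_entropy_le hn (fun w hw => hg w hw.2.1) v fun w hw => ?_
  have h1 := hNU (emp fun i => (v i, w i)) (emp_mem_stdSimplex hn _) (fun a b hab => by
    by_contra hne
    obtain ⟨i, hi⟩ := exists_of_emp_ne_zero hne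
    obtain ⟨rfl, rfl⟩ := Prod.mk.inj hi
    exact hab (hw.2.2 i)) (by rw [push_emp]; exact hw.1) (by rw [push_emp]; exact hw.2.1)
  rw [push_emp] at h1
  rw [ent_emp_swap]
  exact h1

/-- The size of the random codebooks. -/
def bookSize (QX : X → ℝ) (W : X → U → ℝ) (δ : ℝ) (n : ℕ) : ℕ :=
  ⌈(2 : ℝ) ^ (n * (chanInfo QX W + 3 * δ))⌉₊

theorem bookSize_pos (QX : X → ℝ) (W : X → U → ℝ) (δ : ℝ) (n : ℕ) : 0 < bookSize QX W δ n :=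
  Nat.ceil_pos.2 (by positivity)

theorem eventually_bookSize_le {QX : X → ℝ} (hQX : QX ∈ stdSimplex ℝ X) {W : X → U → ℝ}
    (hW : IsChannel W) {δ : ℝ} (hδ : 0 < δ) :
    ∀ᶠ n : ℕ in Filter.atTop, (bookSize QX W δ n : ℝ) ≤ 2 ^ (n * (chanInfo QX W + 4 * δ)) := by
  filter_upwards [eventually_const_le_two_rpow 2 hδ] with n hn
  have h0 := chanInfo_nonneg hQX hW
  have h1 : (1 : ℝ) ≤ 2 ^ (n * (chanInfo QX W + 3 * δ)) :=
    Real.one_le_rpow one_le_two (mul_nonneg n.cast_nonneg (by linarith))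
  have h2 := Nat.ceil_lt_add_one (a := (2 : ℝ) ^ (n * (chanInfo QX W + 3 * δ))) (by positivity)
  calc (bookSize QX W δ n : ℝ) ≤ 2 ^ (n * (chanInfo QX W + 3 * δ)) * 2 := by
        rw [bookSize]; linarith
    _ ≤ 2 ^ (n * (chanInfo QX W + 3 * δ)) * 2 ^ (n * δ) := by gcongr
    _ = _ := by
        rw [← Real.rpow_add two_pos]
        congr 1
        ring

/-- The expected number of admissible codewords is at least `2 ^ (n δ)`, making a miss doubly
exponentially unlikely. -/
theorem le_bookSize_mul {QX : X → ℝ} {W : X → U → ℝ} {δ : ℝ} {n : ℕ} {q : ℝ}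
    (hq : (2 : ℝ) ^ (-(n * (chanInfo QX W + 2 * δ))) ≤ q) :
    (2 : ℝ) ^ (n * δ) ≤ bookSize QX W δ n * q := by
  calc (2 : ℝ) ^ (n * δ) =
        2 ^ (n * (chanInfo QX W + 3 * δ)) * 2 ^ (-(n * (chanInfo QX W + 2 * δ))) := by
        rw [← Real.rpow_add two_pos]
        congr 1
        ring
    _ ≤ _ := mul_le_mul (Nat.le_ceil _) hq (by positivity) (by positivity)

/-- There is a codebook that covers all source words with type near `QX`, in which few codewords
are confusable with a given word. -/
theorem exists_codebook [Nonempty U] {QX : X → ℝ} (hQX : QX ∈ stdSimplex ℝ X)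
    {W : X → U → ℝ} (hW : IsChannel W) (G : SimpleGraph U) {R δ : ℝ} (hR : 0 ≤ R) (hδ : 0 < δ)
    (hκ : kappa G (push Prod.snd (joint QX W)) - condEntropy QX W ≤ R)
    {N : Set (X × U → ℝ)} (hN : N ∈ 𝓝 (joint QX W)) :
    ∃ NU ∈ 𝓝 (push Prod.snd (joint QX W)), ∃ Ω ∈ 𝓝 QX, ∀ᶠ n : ℕ in Filter.atTop,
      ∃ (M t : ℕ) (book : Fin M → Fin n → U), 0 < M ∧ (t : ℝ) ≤ 2 ^ (n * (R + 8 * δ)) ∧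
        (∀ x : Fin n → X, emp x ∈ Ω → ∃ j, Admissible W N x (book j) ∧ emp (book j) ∈ NU) ∧
        ∀ v : Fin n → U, (Finset.univ.filter fun j => Confusable G NU v (book j)).card < t := by
  set QU := push Prod.snd (joint QX W) with hQU
  obtain ⟨g, hg, hgpos, ⟨N₁, hN₁, hgle⟩, hcov⟩ := exists_codeword_law hQX hW hδ
  obtain ⟨N₂, hN₂, hkap⟩ := exists_nhds_kappa (G := G) (Q := QU) hδ
  set N' := N ∩ {J | push Prod.snd J ∈ N₁ ∩ N₂} with hN'def
  have hN' : N' ∈ 𝓝 (joint QX W) := Filter.inter_mem hN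
    ((continuous_push Prod.snd).continuousAt.preimage_mem_nhds (Filter.inter_mem hN₁ hN₂))
  obtain ⟨Ω, hΩ, hcovΩ⟩ := hcov N' hN'
  refine ⟨N₁ ∩ N₂, Filter.inter_mem hN₁ hN₂, Ω, hΩ, ?_⟩
  have hXne : Nonempty X := by
    by_contra h
    rw [not_nonempty_iff] at h
    have := hQX.2
    simp at this
  have hcX : (0 : ℝ) < Fintype.card X := by exact_mod_cast Fintype.card_pos
  have hcU : (0 : ℝ) < Fintype.card U := by exact_mod_cast Fintype.card_pos
  filter_upwards [hcovΩ, eventually_bookSize_le hQX hW hδ,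
    eventually_pow_le_two_rpow (Fintype.card (U × U)) hδ,
    eventually_mul_exp_neg_two_rpow_le (Fintype.card X) 2 hδ hcX,
    eventually_mul_exp_neg_two_rpow_le (Fintype.card U) 2 hδ hcU,
    eventually_const_le_two_rpow 5 hδ, Filter.eventually_gt_atTop 0]
    with n hcn hM hpoly hX hU h5 hn
  have hn1 : (1 : ℝ) ≤ n := by exact_mod_cast hn
  set M := bookSize QX W δ n with hMdef
  -- Bounds the mean number of confusable codewords: `4 δ` comes from the book size, `δ` from the
  -- number of types, `2 δ` from `κ` and the codeword law.
  set β : ℝ := 2 ^ (n * (R + 7 * δ)) with hβ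
  have hβ1 : 1 ≤ β := Real.one_le_rpow one_le_two (by positivity)
  have hβδ : (2 : ℝ) ^ (n * δ) ≤ β :=
    Real.rpow_le_rpow_of_exponent_le one_le_two
      (mul_le_mul_of_nonneg_left (by linarith) n.cast_nonneg)
  have hgs : iidWeight g ∈ stdSimplex ℝ (Fin n → U) := iidWeight_mem_stdSimplex hg
  set t := ⌈4 * β⌉₊ with ht
  have hquarter : (2 : ℝ) ^ (-(n * 2 : ℝ)) ≤ 1 / 4 := by
    calc (2 : ℝ) ^ (-(n * 2 : ℝ)) ≤ 2 ^ (-2 : ℝ) :=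
          Real.rpow_le_rpow_of_exponent_le one_le_two (by linarith)
      _ = 1 / 4 := by
          rw [Real.rpow_neg two_pos.le]
          norm_num
  have hMp : ∀ v : Fin n → U, (M : ℝ) * ∑ w : Fin n → U, iidWeight g w *
      (if Confusable G (N₁ ∩ N₂) v w then 1 else 0) ≤ β := by
    intro v
    have h1 := confusable_weight_le hn (G := G) (NU := N₁ ∩ N₂) (QU := QU) (g := g) (δ := δ)
      (η := ent QU - δ) (fun J hJ hJG h1 h2 => hkap J hJ hJG h1.2 h2.2)
      (fun u hu => hgle n hn u hu.1) v
    calc _ ≤ (2 : ℝ) ^ (n * (chanInfo QX W + 4 * δ)) *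
          (2 ^ (n * δ) * 2 ^ (n * (kappa G QU + δ - (ent QU - δ)))) :=
          mul_le_mul hM (h1.trans (by gcongr)) (Finset.sum_nonneg fun w _ =>
            mul_nonneg (hgs.1 w) (by split_ifs <;> simp)) (by positivity)
      _ ≤ β := by
          rw [← Real.rpow_add two_pos, ← Real.rpow_add two_pos, ← mul_add, ← mul_add]
          refine Real.rpow_le_rpow_of_exponent_le one_le_two
            (mul_le_mul_of_nonneg_left ?_ n.cast_nonneg)
          rw [chanInfo]
          linarith
  have hmiss : ∀ x : Fin n → X, emp x ∈ Ω → ∑ ω : Fin M → Fin n → U, iidWeight (iidWeight g) ω *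
      (if ∀ j, ¬Admissible W N' x (ω j) then 1 else 0) ≤ Real.exp (-(2 : ℝ) ^ (n * δ)) := by
    intro x hx
    have h := sum_iidWeight_miss_le (ι := Fin M) hgs fun u => Admissible W N' x u
    rw [Fintype.card_fin] at h
    exact le_of_eq_of_le (Finset.sum_congr rfl fun ω _ => by congr)
      (h.trans (Real.exp_le_exp.2 (neg_le_neg (le_bookSize_mul (hcn x hx)))))
  have hcount : ∀ v : Fin n → U, ∑ ω : Fin M → Fin n → U, iidWeight (iidWeight g) ω *
      (if t ≤ (Finset.univ.filter fun j => Confusable G (N₁ ∩ N₂) v (ω j)).card then 1 else 0) ≤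
      Real.exp (-(2 : ℝ) ^ (n * δ)) := by
    intro v
    refine (sum_iidWeight_count_le hgs (fun w => Confusable G (N₁ ∩ N₂) v w) t).trans ?_
    rw [Fintype.card_fin, div_le_iff₀ (by positivity)]
    -- This is where the factor `4` in `t` is used: `4 log 2 > 2`.
    have h2t : Real.exp (2 * β) ≤ 2 ^ t := by
      rw [← Real.exp_log (by positivity : (0 : ℝ) < 2 ^ t), Real.log_pow]
      refine Real.exp_le_exp.2 ?_
      have := Nat.le_ceil (4 * β)
      nlinarith [Real.log_two_gt_d9]
    calc _ ≤ Real.exp β := Real.exp_le_exp.2 (hMp v)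
      _ = Real.exp (-β) * Real.exp (2 * β) := by rw [← Real.exp_add]; congr 1; ring
      _ ≤ _ := mul_le_mul (Real.exp_le_exp.2 (neg_le_neg hβδ)) h2t (by positivity) (by positivity)
  set F₁ : (Fin M → Fin n → U) → ℝ := fun ω => ∑ x : Fin n → X, if emp x ∈ Ω then
    (if ∀ j, ¬Admissible W N' x (ω j) then 1 else 0) else 0 with hF₁
  set F₂ : (Fin M → Fin n → U) → ℝ := fun ω => ∑ v : Fin n → U,
    if t ≤ (Finset.univ.filter fun j => Confusable G (N₁ ∩ N₂) v (ω j)).card then 1 else 0 with hF₂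
  have hE₁ : ∑ ω, iidWeight (iidWeight g) ω * F₁ ω ≤ 1 / 4 := by
    calc _ = ∑ x : Fin n → X, if emp x ∈ Ω then ∑ ω : Fin M → Fin n → U,
          iidWeight (iidWeight g) ω * (if ∀ j, ¬Admissible W N' x (ω j) then 1 else 0) else 0 := by
          simp only [hF₁, Finset.mul_sum]
          rw [Finset.sum_comm]
          refine Finset.sum_congr rfl fun x _ => ?_
          split_ifs with hx <;> simp
      _ ≤ ∑ _x : Fin n → X, Real.exp (-(2 : ℝ) ^ (n * δ)) := by
          refine Finset.sum_le_sum fun x _ => ?_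
          split_ifs with hx
          · exact hmiss x hx
          · positivity
      _ ≤ _ := by
          rw [Finset.sum_const, nsmul_eq_mul, Finset.card_univ, Fintype.card_pi_const]
          push_cast
          exact hX.trans hquarter
  have hE₂ : ∑ ω, iidWeight (iidWeight g) ω * F₂ ω ≤ 1 / 4 := by
    calc _ = ∑ v : Fin n → U, ∑ ω : Fin M → Fin n → U, iidWeight (iidWeight g) ω *
          (if t ≤ (Finset.univ.filter fun j => Confusable G (N₁ ∩ N₂) v (ω j)).card
            then 1 else 0) := by
          simp only [hF₂, Finset.mul_sum]
          rw [Finset.sum_comm]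
      _ ≤ ∑ _v : Fin n → U, Real.exp (-(2 : ℝ) ^ (n * δ)) := Finset.sum_le_sum fun v _ => hcount v
      _ ≤ _ := by
          rw [Finset.sum_const, nsmul_eq_mul, Finset.card_univ, Fintype.card_pi_const]
          push_cast
          exact hU.trans hquarter
  -- `F₁` and `F₂` count uncovered source words and overcrowded words; a total of at most one half
  -- forces both counts to be zero.
  obtain ⟨ω, hω⟩ := exists_le_of_sum_mul_le (c := 1 / 2)
    (p := iidWeight (iidWeight g))
    (iidWeight_mem_stdSimplex (ι := Fin M) hgs) (F := fun ω => F₁ ω + F₂ ω) (by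
      simp only [mul_add, Finset.sum_add_distrib]
      linarith)
  have hnn₁ : ∀ x : Fin n → X, (0 : ℝ) ≤ if emp x ∈ Ω then
    (if ∀ j, ¬Admissible W N' x (ω j) then 1 else 0) else 0 := fun x => by split_ifs <;> simp
  have hnn₂ : ∀ v : Fin n → U, (0 : ℝ) ≤
    if t ≤ (Finset.univ.filter fun j => Confusable G (N₁ ∩ N₂) v (ω j)).card then 1 else 0 :=
    fun v => by split_ifs <;> simp
  have hF₁0 : 0 ≤ F₁ ω := Finset.sum_nonneg fun x _ => hnn₁ x
  have hF₂0 : 0 ≤ F₂ ω := Finset.sum_nonneg fun v _ => hnn₂ v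
  refine ⟨M, t, ω, bookSize_pos QX W δ n, ?_, fun x hx => ?_, fun v => ?_⟩
  · have h1 := Nat.ceil_lt_add_one (a := 4 * β) (by positivity)
    calc (t : ℝ) ≤ 5 * β := by linarith
      _ ≤ 2 ^ (n * δ) * β := by gcongr
      _ = _ := by
        rw [hβ, ← Real.rpow_add two_pos]
        congr 1
        ring
  · have h3 : ∃ j, Admissible W N' x (ω j) := by
      by_contra! hno
      have h1 := Finset.single_le_sum (fun x _ => hnn₁ x) (Finset.mem_univ x)
      rw [if_pos hx, if_pos hno] at h1
      have h2 : (1 : ℝ) ≤ F₁ ω := h1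
      linarith
    obtain ⟨j, hj⟩ := h3
    have h4 : push Prod.snd (emp fun i => (x i, ω j i)) ∈ N₁ ∩ N₂ := hj.1.2
    rw [push_emp] at h4
    exact ⟨j, ⟨hj.1.1, hj.2⟩, h4⟩
  · by_contra! hno
    have h1 := Finset.single_le_sum (fun v _ => hnn₂ v) (Finset.mem_univ v)
    rw [if_pos hno] at h1
    have h2 : (1 : ℝ) ≤ F₂ ω := h1
    linarith

/-- If `κ₂` does not exceed the rate, the description can be recovered without error. -/
theorem exists_zeroError_code [Nonempty Z] [Nonempty U] {P : X × Y → ℝ}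
    (hP : P ∈ stdSimplex ℝ (X × Y)) {d : X → Z → ℝ} {R Δ L L' δ : ℝ} {b : Prop} (hR : 0 ≤ R)
    (hδ : 0 < δ) (hL : L + δ ≤ L') {QX : X → ℝ} (hQX : QX ∈ stdSimplex ℝ X) {W : X → U → ℝ}
    (hW : IsChannel W) (hκ : kappa₂ P QX W ≤ R) {N : Set (X × U → ℝ)} (hN : N ∈ 𝓝 (joint QX W))
    (hφ : ∀ QY ∈ stdSimplex ℝ Y, ∃ φ : Y → U → Z, ∀ Q, push pairXU Q ∈ N →
      push (fun q => q.2.1) Q = QY → Q ∉ badSet P d R Δ L' b φ) :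
    ∃ Ω ∈ 𝓝 QX, ∀ᶠ n : ℕ in Filter.atTop, HasRegionCode P d Δ (R + 8 * δ) L Ω n := by
  have hκ' : kappa (charGraph (inducedUY P W)) (push Prod.snd (joint QX W)) - condEntropy QX W ≤
      R := by
    have h : (fun u => ∑ x, QX x * W x u) = push Prod.snd (joint QX W) :=
      funext fun u => (push_snd_apply (joint QX W) u).symm
    rw [kappa₂, h] at hκ
    exact (le_max_right _ _).trans hκ
  choose Φ hΦ using hφ
  obtain ⟨NU, hNU, Ω, hΩ, hev⟩ := exists_codebook hQX hW (charGraph (inducedUY P W)) hR hδ hκ'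
    hN
  refine ⟨Ω, hΩ, ?_⟩
  filter_upwards [hev, eventually_pow_le_two_rpow (Fintype.card (X × Y × U)) hδ,
    Filter.eventually_gt_atTop 0] with n ⟨M, t, book, hM, ht, hcov, hdeg⟩ hpoly hn
  obtain ⟨col, hcol⟩ := exists_greedy_coloring
    (r := fun i j => Confusable (charGraph (inducedUY P W)) NU (book i) (book j))
    (fun i j h => h.symm) fun i => hdeg (book i)
  have hc : ∀ x : Fin n → X, ∃ j, emp x ∈ Ω → Admissible W N x (book j) ∧ emp (book j) ∈ NU := by
    intro x
    by_cases hx : emp x ∈ Ω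
    · obtain ⟨j, hj⟩ := hcov x hx
      exact ⟨j, fun _ => hj⟩
    · exact ⟨⟨0, hM⟩, fun h => absurd h hx⟩
  choose c hc using hc
  set ok : Fin t → (Fin n → Y) → Fin M → Prop := fun k y j =>
    col j = k ∧ emp (book j) ∈ NU ∧ ∀ i, 0 < inducedUY P W (book j i, y i) with hok
  -- The decoder takes any codeword of the received colour that is letterwise compatible with `y`.
  -- Two such codewords would be confusable, hence differently coloured, so the choice is forced.
  set g : Fin t → (Fin n → Y) → Fin n → Z := fun k y i =>
    if h : ∃ j, ok k y j then Φ (emp y) (emp_mem_stdSimplex hn y) (y i) (book h.choose i)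
    else Classical.arbitrary Z with hg
  refine ⟨t, fun x => col (c x), g, ht, ?_⟩
  have hdec : ∀ x y, emp x ∈ Ω → ∏ i, P (x i, y i) ≠ 0 → ∀ i, g (col (c x)) y i =
      Φ (emp y) (emp_mem_stdSimplex hn y) (y i) (book (c x) i) := by
    intro x y hx hPne i
    have hPpos : ∀ i, 0 < P (x i, y i) := fun i =>
      lt_of_le_of_ne (hP.1 _) (Ne.symm (Finset.prod_ne_zero_iff.1 hPne i (Finset.mem_univ i)))
    -- The transmitted codeword is compatible because admissibility includes `W (x i) (u i) > 0`.
    have hokc : ok (col (c x)) y (c x) := by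
      refine ⟨rfl, (hc x hx).2, fun i => ?_⟩
      exact Finset.sum_pos' (fun a _ => mul_nonneg (hP.1 _) ((hW a).1 _))
        ⟨x i, Finset.mem_univ _, mul_pos (hPpos i) ((hc x hx).1.2 i)⟩
    have hex : ∃ j, ok (col (c x)) y j := ⟨c x, hokc⟩
    have hspec := hex.choose_spec
    have heq : hex.choose = c x := by
      by_contra hne
      refine hcol _ _ hne ⟨hspec.2.1, hokc.2.1, fun i => ?_⟩ hspec.1
      by_cases h : book hex.choose i = book (c x) i
      · exact Or.inl h
      · exact Or.inr ⟨h, y i, hspec.2.2 i, hokc.2.2 i⟩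
    simp only [hg]
    rw [dif_pos hex, heq]
  refine le_trans (Finset.sum_le_sum fun x _ => Finset.sum_le_sum fun y _ => ?_)
    ((sum_types_large_le hn hP.1 L' fun x => book (c x)).trans ?_)
  · have hnn : ∀ Q : X × Y × U → ℝ, 0 ≤
        if emp (fun i => (x i, y i, book (c x) i)) = Q then ∏ i, P (x i, y i) else 0 := fun Q => by
      split_ifs
      · exact Finset.prod_nonneg fun i _ => hP.1 _
      · exact le_rfl
    by_cases hPne : ∏ i, P (x i, y i) = 0
    · simp [hPne]
    split_ifs with hxe
    swap
    · exact Finset.sum_nonneg fun Q _ => hnn Q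
    obtain ⟨hx, herr⟩ := hxe
    rw [Finset.sum_congr rfl fun i _ => by rw [hdec x y hx hPne i]] at herr
    have hbad := hΦ (emp y) (emp_mem_stdSimplex hn y)
      (emp fun i => (x i, y i, book (c x) i)) (by rw [push_emp]; exact (hc x hx).1.1)
      (by rw [push_emp]; rfl)
    have h1 := (lt_of_emp_notMem_badSet hn hPne hbad).1 herr
    have hmem : (emp fun i => (x i, y i, book (c x) i)) ∈
        (types (X × Y × U) n).filter fun Q => L' < divEnt P Q :=
      Finset.mem_filter.2 ⟨emp_mem_types _, h1⟩
    have h2 := Finset.single_le_sum (fun Q _ => hnn Q) hmem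
    rwa [if_pos rfl] at h2
  · calc _ ≤ (2 : ℝ) ^ (n * δ) * 2 ^ (-(n * L')) := by gcongr
      _ ≤ _ := by
        rw [← Real.rpow_add two_pos]
        refine Real.rpow_le_rpow_of_exponent_le one_le_two ?_
        have : (0 : ℝ) ≤ n := n.cast_nonneg
        nlinarith

end ZeroError

/-! ### Random binning and minimum-entropy decoding -/

section Binning

open scoped Classical

set_option linter.unusedSectionVars false

variable {V X Y Z U : Type*} [Fintype V] [Fintype X] [Fintype Y] [Fintype U]

/-- The law of a random word together with an independent uniform bin index. -/
def binLaw (γ : V → ℝ) (K : ℕ) (a : V × Fin K) : ℝ := γ a.1 / K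

theorem sum_binLaw_mul {K : ℕ} (hK : 0 < K) (γ f : V → ℝ) :
    ∑ a, binLaw γ K a * f a.1 = ∑ v, γ v * f v := by
  have hK' : (K : ℝ) ≠ 0 := by positivity
  rw [Fintype.sum_prod_type]
  refine Finset.sum_congr rfl fun v _ => ?_
  simp only [binLaw, Finset.sum_const, Finset.card_univ, Fintype.card_fin, nsmul_eq_mul]
  field_simp

theorem binLaw_mem_stdSimplex {K : ℕ} (hK : 0 < K) {γ : V → ℝ} (hγ : γ ∈ stdSimplex ℝ V) :
    binLaw γ K ∈ stdSimplex ℝ (V × Fin K) := by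
  refine ⟨fun a => div_nonneg (hγ.1 _) K.cast_nonneg, ?_⟩
  have := sum_binLaw_mul hK γ fun _ => 1
  simpa [hγ.2] using this

/-- Distinct codewords are independent and share a bin with probability `1 / K`, independently of
the words themselves. -/
theorem sum_iidWeight_binLaw_pair {M K : ℕ} (hK : 0 < K) {γ : V → ℝ} (hγ : γ ∈ stdSimplex ℝ V)
    {j i : Fin M} (hij : j ≠ i) (T S : V → Prop) :
    ∑ ω : Fin M → V × Fin K, iidWeight (binLaw γ K) ω *
      (if T (ω j).1 ∧ S (ω i).1 ∧ (ω i).2 = (ω j).2 then 1 else 0) =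
    (∑ v, γ v * if T v then 1 else 0) * (∑ v, γ v * if S v then 1 else 0) / K := by
  have hK' : (K : ℝ) ≠ 0 := by positivity
  rw [sum_iidWeight_pair (binLaw_mem_stdSimplex hK hγ).2 hij
    fun a b : V × Fin K => if T a.1 ∧ S b.1 ∧ b.2 = a.2 then (1 : ℝ) else 0]
  have h1 : ∀ a : V × Fin K, ∑ b : V × Fin K, binLaw γ K a * binLaw γ K b *
      (if T a.1 ∧ S b.1 ∧ b.2 = a.2 then (1 : ℝ) else 0) = binLaw γ K a *
        ((if T a.1 then 1 else 0) * ((∑ v, γ v * if S v then 1 else 0) / K)) := by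
    intro a
    rw [Fintype.sum_prod_type, Finset.sum_div, Finset.mul_sum, Finset.mul_sum]
    refine Finset.sum_congr rfl fun v _ => ?_
    rw [Finset.sum_eq_single a.2]
    · by_cases hT : T a.1 <;> by_cases hS : S v <;> simp [hT, hS, binLaw]
    · intro l _ hl
      simp [hl]
    · simp
  rw [Finset.sum_congr rfl fun a _ => h1 a, sum_binLaw_mul hK γ fun v =>
    (if T v then 1 else 0) * ((∑ v, γ v * if S v then 1 else 0) / K), mul_div_assoc,
    Finset.sum_mul]
  exact Finset.sum_congr rfl fun v _ => by ring

/-- The words that compete at the decoder with a description of joint type `Q`. -/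
def Competes (N₁ : Set (U → ℝ)) (Q : X × Y × U → ℝ) {n : ℕ} (y : Fin n → Y) (u : Fin n → U) :
    Prop :=
  emp u ∈ N₁ ∧ ent (emp fun i => (u i, y i)) ≤ ent (push Prod.snd Q)

/-- The expected probability of a decoding error for descriptions of joint type `Q`. -/
theorem sum_competes_le {n M K : ℕ} (hn : 0 < n) (hK : 0 < K) {P : X × Y → ℝ}
    (hP : ∀ p, 0 ≤ P p) {g : U → ℝ} (hg : g ∈ stdSimplex ℝ U) (hgpos : ∀ b, 0 < g b)
    {N₁ : Set (U → ℝ)} {η : ℝ}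
    (hgle : ∀ u : Fin n → U, emp u ∈ N₁ → iidWeight g u ≤ 2 ^ (-(n * η)))
    {Q : X × Y × U → ℝ} (hQ : Q ∈ stdSimplex ℝ (X × Y × U)) :
    ∑ ω : Fin M → (Fin n → U) × Fin K, iidWeight (binLaw (iidWeight g) K) ω *
      ∑ x : Fin n → X, ∑ y : Fin n → Y, (∏ i, P (x i, y i)) * ∑ j, ∑ i, (if j ≠ i then
        (if emp (fun l => (x l, y l, (ω j).1 l)) = Q ∧ Competes N₁ Q y (ω i).1 ∧
          (ω i).2 = (ω j).2 then 1 else 0) else 0) ≤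
    (M : ℝ) ^ 2 / K * (((n : ℝ) + 1) ^ Fintype.card (U × Y) *
      2 ^ (n * (ent (push (fun q => q.2.2) Q) - η - divEnt P Q - infoXU Q - infoYU Q))) := by
  set B : ℝ := ((n : ℝ) + 1) ^ Fintype.card (U × Y) *
    2 ^ (n * (ent (push Prod.snd Q) - ent (push (fun q => q.2.1) Q) - η)) with hB
  have hB0 : 0 ≤ B := by positivity
  have hgs : iidWeight g ∈ stdSimplex ℝ (Fin n → U) := iidWeight_mem_stdSimplex hg
  set γT : (Fin n → X) → (Fin n → Y) → ℝ := fun x y => ∑ u : Fin n → U, iidWeight g u *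
    (if emp (fun i => (x i, y i, u i)) = Q then 1 else 0) with hγT
  have hγT0 : ∀ x y, 0 ≤ γT x y := fun x y => Finset.sum_nonneg fun u _ =>
    mul_nonneg (hgs.1 u) (by split_ifs <;> simp)
  have hprod : ∀ x y, γT x y * ∑ u : Fin n → U, iidWeight g u *
      (if Competes N₁ Q y u then 1 else 0) ≤ γT x y * B := by
    intro x y
    -- `γT` vanishes unless `y` has the type prescribed by `Q`, so `H(U | Y)` may be measured with
    -- the marginal of `Q`.
    by_cases hy : emp y = push (fun q => q.2.1) Q
    · refine mul_le_mul_of_nonneg_left ?_ (hγT0 x y)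
      refine sum_small_entropy_le hn (fun u hu => hgle u hu.1) y fun u hu => ?_
      rw [hy]
      exact sub_le_sub_right hu.2 _
    · have : γT x y = 0 := by
        refine Finset.sum_eq_zero fun u _ => ?_
        rw [if_neg, mul_zero]
        intro hE
        refine hy ?_
        rw [← hE, push_emp]
        rfl
      rw [this, zero_mul, zero_mul]
  have hpair : ∀ x y (j i : Fin M), ∑ ω : Fin M → (Fin n → U) × Fin K,
      iidWeight (binLaw (iidWeight g) K) ω * (if j ≠ i then
        (if emp (fun l => (x l, y l, (ω j).1 l)) = Q ∧ Competes N₁ Q y (ω i).1 ∧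
          (ω i).2 = (ω j).2 then 1 else 0) else 0) ≤ γT x y * B / K := by
    intro x y j i
    by_cases hji : j ≠ i
    · simp only [if_pos hji]
      have h := sum_iidWeight_binLaw_pair hK hgs hji (fun u => emp (fun l => (x l, y l, u l)) = Q)
        fun u => Competes N₁ Q y u
      refine (le_of_eq (Eq.trans (Finset.sum_congr rfl fun ω _ => by congr) h)).trans ?_
      refine div_le_div_of_nonneg_right (le_of_eq_of_le ?_ (hprod x y)) K.cast_nonneg
      congr 1
      exact Finset.sum_congr rfl fun u _ => by congr
    · simp only [if_neg hji, mul_zero, Finset.sum_const_zero]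
      exact div_nonneg (mul_nonneg (hγT0 x y) hB0) K.cast_nonneg
  have hp0 : ∀ (x : Fin n → X) (y : Fin n → Y), 0 ≤ ∏ i, P (x i, y i) := fun x y =>
    Finset.prod_nonneg fun i _ => hP _
  -- Gibbs' inequality for the `U`-marginal: independence of codeword and source costs the
  -- additional exponent `I(X;U)`.
  have hexp : ent Q + ∑ q, Q q * Real.logb 2 (P (q.1, q.2.1)) +
      ∑ b, push (fun q => q.2.2) Q b * Real.logb 2 (g b) ≤ -divEnt P Q - infoXU Q := by
    have h1 := ent_le_cross (push_mem_stdSimplex hQ fun q => q.2.2) hg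
      fun a h => absurd h (hgpos a).ne'
    rw [divEnt, infoXU]
    linarith
  calc _ = ∑ x : Fin n → X, ∑ y : Fin n → Y, (∏ i, P (x i, y i)) * ∑ j : Fin M, ∑ i : Fin M,
        ∑ ω : Fin M → (Fin n → U) × Fin K, iidWeight (binLaw (iidWeight g) K) ω *
          (if j ≠ i then (if emp (fun l => (x l, y l, (ω j).1 l)) = Q ∧
            Competes N₁ Q y (ω i).1 ∧ (ω i).2 = (ω j).2 then 1 else 0) else 0) := by
        simp only [Finset.mul_sum]
        rw [Finset.sum_comm]
        refine Finset.sum_congr rfl fun x _ => ?_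
        rw [Finset.sum_comm]
        refine Finset.sum_congr rfl fun y _ => ?_
        rw [Finset.sum_comm]
        refine Finset.sum_congr rfl fun j _ => ?_
        rw [Finset.sum_comm]
        exact Finset.sum_congr rfl fun i _ => Finset.sum_congr rfl fun ω _ => by ring
    _ ≤ ∑ x : Fin n → X, ∑ y : Fin n → Y, (∏ i, P (x i, y i)) * ∑ _j : Fin M, ∑ _i : Fin M,
        γT x y * B / K :=
        Finset.sum_le_sum fun x _ => Finset.sum_le_sum fun y _ =>
          mul_le_mul_of_nonneg_left (Finset.sum_le_sum fun j _ => Finset.sum_le_sum fun i _ =>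
            hpair x y j i) (hp0 x y)
    _ = (M : ℝ) ^ 2 / K * B *
        ∑ x : Fin n → X, ∑ y : Fin n → Y, (∏ i, P (x i, y i)) * γT x y := by
        simp only [Finset.sum_const, Finset.card_univ, Fintype.card_fin, nsmul_eq_mul,
          Finset.mul_sum]
        exact Finset.sum_congr rfl fun x _ => Finset.sum_congr rfl fun y _ => by ring
    _ ≤ (M : ℝ) ^ 2 / K * B * 2 ^ (n * (-divEnt P Q - infoXU Q)) := by
        refine mul_le_mul_of_nonneg_left ((sum_indep_type_le hn hP hgpos Q).trans ?_)
          (by positivity)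
        exact Real.rpow_le_rpow_of_exponent_le one_le_two
          (mul_le_mul_of_nonneg_left hexp n.cast_nonneg)
    _ = _ := by
        rw [hB, mul_assoc, mul_assoc, ← Real.rpow_add two_pos]
        congr 3
        rw [infoYU]
        ring

theorem sum_prod_pair_eq_one {P : X × Y → ℝ} (hP : P ∈ stdSimplex ℝ (X × Y)) (n : ℕ) :
    ∑ x : Fin n → X, ∑ y : Fin n → Y, ∏ i, P (x i, y i) = 1 := by
  have h := sum_prod_eq fun (_ : Fin n) p => P p
  rw [hP.2, Finset.prod_const_one, ← Equiv.sum_comp (Equiv.arrowProdEquivProdArrow (Fin n)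
    (fun _ => X) fun _ => Y).symm, Fintype.sum_prod_type] at h
  exact h

/-- Random binning with a minimum-entropy decoder. -/
theorem exists_binning_code [Nonempty U] {P : X × Y → ℝ}
    (hP : P ∈ stdSimplex ℝ (X × Y)) {d : X → Z → ℝ} {R Δ L L' δ : ℝ} {b : Prop} (hb : b)
    (hR : 0 ≤ R) (hδ : 0 < δ) (hL : L + 15 * δ ≤ L') {QX : X → ℝ} (hQX : QX ∈ stdSimplex ℝ X)
    {W : X → U → ℝ} (hW : IsChannel W) {N : Set (X × U → ℝ)} (hN : N ∈ 𝓝 (joint QX W))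
    (hφ : ∀ QY ∈ stdSimplex ℝ Y, ∃ φ : Y → U → Z, ∀ Q, push pairXU Q ∈ N →
      push (fun q => q.2.1) Q = QY → Q ∉ badSet P d R Δ L' b φ) :
    ∃ Ω ∈ 𝓝 QX, ∀ᶠ n : ℕ in Filter.atTop, HasRegionCode P d Δ (R + 8 * δ) L Ω n := by
  choose Φ hΦ using hφ
  obtain ⟨g, hg, hgpos, ⟨N₁, hN₁, hgle⟩, hcov⟩ := exists_codeword_law hQX hW hδ
  set J₀ := joint QX W with hJ₀
  set QU := push Prod.snd J₀ with hQU
  -- On `N'` the codeword weight bound applies, `H(U)` exceeds its target by less than `δ`, and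
  -- `I(X;U)` falls short by less than `δ`.
  set N' : Set (X × U → ℝ) := N ∩ ({J | push Prod.snd J ∈ N₁} ∩
    ({J | ent (push Prod.snd J) < ent QU + δ} ∩
    {J | chanInfo QX W - δ < ent (push Prod.fst J) + ent (push Prod.snd J) - ent J})) with hN'def
  have hN' : N' ∈ 𝓝 J₀ := by
    refine Filter.inter_mem hN (Filter.inter_mem
      ((continuous_push Prod.snd).continuousAt.preimage_mem_nhds hN₁) (Filter.inter_mem
      ((isOpen_lt (by fun_prop) continuous_const).mem_nhds ?_)
      ((isOpen_lt continuous_const (by fun_prop)).mem_nhds ?_)))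
    · change ent QU < ent QU + δ
      linarith
    · change chanInfo QX W - δ < ent (push Prod.fst J₀) + ent QU - ent J₀
      rw [hJ₀, push_fst_joint hW, ent_joint hW, chanInfo]
      linarith
  obtain ⟨Ω, hΩ, hcovΩ⟩ := hcov N' hN'
  refine ⟨Ω, hΩ, ?_⟩
  filter_upwards [hcovΩ, eventually_bookSize_le hQX hW hδ,
    eventually_pow_le_two_rpow (Fintype.card (U × Y)) hδ,
    eventually_pow_le_two_rpow (Fintype.card (X × Y × U)) hδ,
    eventually_mul_exp_neg_two_rpow_le 1 L' hδ one_pos,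
    eventually_const_le_two_rpow 3 hδ, Filter.eventually_gt_atTop 0]
    with n hcn hM hpoly hpolyQ hexp h3 hn
  rw [one_pow, one_mul] at hexp
  have hn0 : (0 : ℝ) < n := by exact_mod_cast hn
  set M := bookSize QX W δ n with hMdef
  have hMpos : 0 < M := bookSize_pos QX W δ n
  set K := ⌈(2 : ℝ) ^ (n * R)⌉₊ with hKdef
  have hKpos : 0 < K := Nat.ceil_pos.2 (by positivity)
  have hKge : (2 : ℝ) ^ (n * R) ≤ K := Nat.le_ceil _
  have hKle : (K : ℝ) ≤ 2 ^ (n * (R + 8 * δ)) := by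
    have h1 := Nat.ceil_lt_add_one (a := (2 : ℝ) ^ (n * R)) (by positivity)
    have h2 : (1 : ℝ) ≤ 2 ^ (n * R) := Real.one_le_rpow one_le_two (by positivity)
    calc (K : ℝ) ≤ 2 ^ (n * R) * 3 := by linarith
      _ ≤ 2 ^ (n * R) * 2 ^ (n * δ) := by gcongr
      _ = 2 ^ (n * (R + δ)) := by
        rw [← Real.rpow_add two_pos]
        congr 1
        ring
      _ ≤ _ := Real.rpow_le_rpow_of_exponent_le one_le_two
        (mul_le_mul_of_nonneg_left (by linarith) hn0.le)
  have hgs : iidWeight g ∈ stdSimplex ℝ (Fin n → U) := iidWeight_mem_stdSimplex hg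
  set μ := binLaw (iidWeight g : (Fin n → U) → ℝ) K with hμdef
  have hμ : μ ∈ stdSimplex ℝ ((Fin n → U) × Fin K) := binLaw_mem_stdSimplex hKpos hgs
  have hμM : iidWeight μ ∈ stdSimplex ℝ (Fin M → (Fin n → U) × Fin K) :=
    iidWeight_mem_stdSimplex hμ
  have hc : ∀ (ω : Fin M → (Fin n → U) × Fin K) (x : Fin n → X), ∃ j,
      (∃ j', Admissible W N' x (ω j').1) → Admissible W N' x (ω j).1 := by
    intro ω x
    by_cases h : ∃ j', Admissible W N' x (ω j').1
    · exact h.imp fun j hj _ => hj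
    · exact ⟨⟨0, hMpos⟩, fun h' => absurd h' h⟩
  choose c hc using hc
  -- As `y` is known, least joint entropy with `y` means least conditional entropy given `y`.
  have hdec : ∀ (ω : Fin M → (Fin n → U) × Fin K) (k : Fin K) (y : Fin n → Y), ∃ i,
      ∀ j, (ω j).2 = k → emp (ω j).1 ∈ N₁ → (ω i).2 = k ∧ emp (ω i).1 ∈ N₁ ∧
        ent (emp fun l => ((ω i).1 l, y l)) ≤ ent (emp fun l => ((ω j).1 l, y l)) := by
    intro ω k y
    by_cases h : (Finset.univ.filter fun j => (ω j).2 = k ∧ emp (ω j).1 ∈ N₁).Nonempty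
    · obtain ⟨i, hi, hmin⟩ := Finset.exists_min_image _
        (fun j => ent (emp fun l => ((ω j).1 l, y l))) h
      refine ⟨i, fun j hj hjN => ?_⟩
      have hi' := (Finset.mem_filter.1 hi).2
      exact ⟨hi'.1, hi'.2, hmin j (Finset.mem_filter.2 ⟨Finset.mem_univ _, hj, hjN⟩)⟩
    · exact ⟨⟨0, hMpos⟩, fun j hj hjN => absurd
        ⟨j, Finset.mem_filter.2 ⟨Finset.mem_univ _, hj, hjN⟩⟩ h⟩
  choose dec hdec using hdec
  set f : (Fin M → (Fin n → U) × Fin K) → (Fin n → X) → Fin K := fun ω x => (ω (c ω x)).2 with hf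
  set gd : (Fin M → (Fin n → U) × Fin K) → Fin K → (Fin n → Y) → Fin n → Z := fun ω k y i =>
    Φ (emp y) (emp_mem_stdSimplex hn y) (y i) ((ω (dec ω k y)).1 i) with hgd
  set T₃ := (types (X × Y × U) n).filter fun Q =>
    L' < divEnt P Q + (R - infoXU Q + infoYU Q) ∧ push pairXU Q ∈ N' with hT₃
  -- The three error events: no admissible codeword; a joint type of divergence above `L'`; a
  -- competitor in the same bin. The last is summed over all pairs of codewords, which removes the
  -- dependence on the encoder's choice.
  set A₁ : (Fin M → (Fin n → U) × Fin K) → ℝ := fun ω => ∑ x : Fin n → X, ∑ y : Fin n → Y,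
    if emp x ∈ Ω ∧ ∀ j, ¬Admissible W N' x (ω j).1 then ∏ i, P (x i, y i) else 0 with hA₁
  set A₂ : (Fin M → (Fin n → U) × Fin K) → ℝ := fun ω => ∑ x : Fin n → X, ∑ y : Fin n → Y,
    ∑ Q ∈ (types (X × Y × U) n).filter fun Q => L' < divEnt P Q,
      (if emp (fun i => (x i, y i, (ω (c ω x)).1 i)) = Q then ∏ i, P (x i, y i) else 0) with hA₂
  set A₃ : (X × Y × U → ℝ) → (Fin M → (Fin n → U) × Fin K) → ℝ := fun Q ω =>
    ∑ x : Fin n → X, ∑ y : Fin n → Y, (∏ i, P (x i, y i)) * ∑ j, ∑ i, (if j ≠ i then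
      (if emp (fun l => (x l, y l, (ω j).1 l)) = Q ∧ Competes N₁ Q y (ω i).1 ∧
          (ω i).2 = (ω j).2 then 1 else 0) else 0) with hA₃
  have hp0 : ∀ (x : Fin n → X) (y : Fin n → Y), 0 ≤ ∏ i, P (x i, y i) := fun x y =>
    Finset.prod_nonneg fun i _ => hP.1 _
  have hptw : ∀ ω, ∑ x : Fin n → X, ∑ y : Fin n → Y,
      (if emp x ∈ Ω ∧ Δ < (∑ i, d (x i) (gd ω (f ω x) y i)) / n then
        ∏ i, P (x i, y i) else 0) ≤ A₁ ω + A₂ ω + ∑ Q ∈ T₃, A₃ Q ω := by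
    intro ω
    have hswap : ∑ Q ∈ T₃, A₃ Q ω = ∑ x : Fin n → X, ∑ y : Fin n → Y, ∑ Q ∈ T₃,
        (∏ i, P (x i, y i)) * ∑ j, ∑ i, (if j ≠ i then
          (if emp (fun l => (x l, y l, (ω j).1 l)) = Q ∧ Competes N₁ Q y (ω i).1 ∧
            (ω i).2 = (ω j).2 then 1 else 0) else 0) := by
      simp only [hA₃]
      rw [Finset.sum_comm]
      exact Finset.sum_congr rfl fun x _ => Finset.sum_comm
    rw [hswap]
    simp only [hA₁, hA₂]
    rw [← Finset.sum_add_distrib, ← Finset.sum_add_distrib]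
    refine Finset.sum_le_sum fun x _ => ?_
    rw [← Finset.sum_add_distrib, ← Finset.sum_add_distrib]
    refine Finset.sum_le_sum fun y _ => ?_
    have hn₁ : 0 ≤ if emp x ∈ Ω ∧ ∀ j, ¬Admissible W N' x (ω j).1 then ∏ i, P (x i, y i) else 0 := by
      split_ifs
      exacts [hp0 x y, le_rfl]
    have hn₂ : ∀ Q, 0 ≤ if emp (fun i => (x i, y i, (ω (c ω x)).1 i)) = Q then
        ∏ i, P (x i, y i) else 0 := fun Q => by
      split_ifs
      exacts [hp0 x y, le_rfl]
    have hn₃ : ∀ Q (j i : Fin M), (0 : ℝ) ≤ if j ≠ i then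
        (if emp (fun l => (x l, y l, (ω j).1 l)) = Q ∧ Competes N₁ Q y (ω i).1 ∧
          (ω i).2 = (ω j).2 then 1 else 0) else 0 := fun Q j i => by
      split_ifs <;> norm_num
    have hs₂ := Finset.sum_nonneg fun Q (_ : Q ∈ (types (X × Y × U) n).filter fun Q =>
      L' < divEnt P Q) => hn₂ Q
    have hn₃' : ∀ Q, 0 ≤ (∏ i, P (x i, y i)) * ∑ j, ∑ i, (if j ≠ i then
        (if emp (fun l => (x l, y l, (ω j).1 l)) = Q ∧ Competes N₁ Q y (ω i).1 ∧
          (ω i).2 = (ω j).2 then (1 : ℝ) else 0) else 0) := fun Q =>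
      mul_nonneg (hp0 x y) (Finset.sum_nonneg fun j _ => Finset.sum_nonneg fun i _ => hn₃ Q j i)
    have hs₃ := Finset.sum_nonneg fun Q (_ : Q ∈ T₃) => hn₃' Q
    by_cases hPne : ∏ i, P (x i, y i) = 0
    · rw [hPne, ite_self]
      rw [hPne] at hn₁ hs₂ hs₃
      linarith
    by_cases herr : emp x ∈ Ω ∧ Δ < (∑ i, d (x i) (gd ω (f ω x) y i)) / n
    swap
    · rw [if_neg herr]
      linarith
    rw [if_pos herr]
    by_cases hex : ∃ j, Admissible W N' x (ω j).1
    swap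
    · push Not at hex
      rw [if_pos ⟨herr.1, hex⟩]
      linarith
    have hadm := hc ω x hex
    set j := c ω x with hj
    set Q := emp fun i => (x i, y i, (ω j).1 i) with hQ
    have hQt : Q ∈ types (X × Y × U) n := emp_mem_types _
    have hQXU : push pairXU Q ∈ N' := by
      rw [hQ, push_emp]
      exact hadm.1
    have hbad := hΦ (emp y) (emp_mem_stdSimplex hn y) Q hQXU.1 (by rw [hQ, push_emp]; rfl)
    have hlt := lt_of_emp_notMem_badSet hn hPne hbad
    by_cases hD : L' < divEnt P Q
    · have hmem : Q ∈ (types (X × Y × U) n).filter fun Q => L' < divEnt P Q :=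
        Finset.mem_filter.2 ⟨hQt, hD⟩
      have h1 := Finset.single_le_sum (fun Q _ => hn₂ Q) hmem
      rw [if_pos rfl] at h1
      linarith
    · have h1 := hlt.2 hb
      -- Once `D ≤ L'`, the positive part cannot be zero, so it may be dropped.
      have h2 : L' < divEnt P Q + (R - infoXU Q + infoYU Q) := by
        rcases max_choice 0 (R - infoXU Q + infoYU Q) with h | h
        · rw [h, add_zero] at h1
          exact absurd h1 hD
        · rwa [h] at h1
      have hmem : Q ∈ T₃ := Finset.mem_filter.2 ⟨hQt, h2, hQXU⟩
      have hjN₁ : emp (ω j).1 ∈ N₁ := by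
        have := hQXU.2.1
        change push Prod.snd (push pairXU Q) ∈ N₁ at this
        rwa [push_push, hQ, push_emp] at this
      obtain ⟨hi1, hi2, hi3⟩ := hdec ω (f ω x) y j rfl hjN₁
      -- Had the right codeword been decoded, excess distortion would give `D > L'`.
      have hji : j ≠ dec ω (f ω x) y := by
        intro h
        refine hD (hlt.1 ?_)
        have := herr.2
        simp only [hgd] at this
        rwa [← h] at this
      have hcomp : Competes N₁ Q y (ω (dec ω (f ω x) y)).1 := by
        refine ⟨hi2, hi3.trans_eq ?_⟩
        rw [ent_emp_swap, hQ, push_emp]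
        rfl
      have h3 := Finset.single_le_sum (fun Q _ => hn₃' Q) hmem
      have h4 : (1 : ℝ) ≤ ∑ j, ∑ i, (if j ≠ i then
          (if emp (fun l => (x l, y l, (ω j).1 l)) = Q ∧ Competes N₁ Q y (ω i).1 ∧
            (ω i).2 = (ω j).2 then (1 : ℝ) else 0) else 0) := by
        refine le_trans ?_ (Finset.single_le_sum (fun j _ => Finset.sum_nonneg fun i _ =>
          hn₃ Q j i) (Finset.mem_univ j))
        refine le_trans ?_ (Finset.single_le_sum (fun i _ => hn₃ Q j i)
          (Finset.mem_univ (dec ω (f ω x) y)))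
        rw [if_pos hji, if_pos ⟨rfl, hcomp, hi1⟩]
      have h5 := mul_le_mul_of_nonneg_left h4 (hp0 x y)
      linarith
  have hE₁ : ∑ ω, iidWeight μ ω * A₁ ω ≤ 2 ^ (-(n * L')) := by
    have hmiss : ∀ x : Fin n → X, emp x ∈ Ω → ∑ ω : Fin M → (Fin n → U) × Fin K,
        iidWeight μ ω * (if ∀ j, ¬Admissible W N' x (ω j).1 then 1 else 0) ≤ 2 ^ (-(n * L')) := by
      intro x hx
      have h := sum_iidWeight_miss_le (ι := Fin M) hμ fun a => Admissible W N' x a.1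
      rw [Fintype.card_fin, sum_binLaw_mul hKpos (iidWeight g : (Fin n → U) → ℝ) fun u =>
        if Admissible W N' x u then 1 else 0] at h
      refine le_of_eq_of_le (Finset.sum_congr rfl fun ω _ => by congr) (h.trans ?_)
      exact (Real.exp_le_exp.2 (neg_le_neg (le_bookSize_mul (hcn x hx)))).trans hexp
    calc _ = ∑ x : Fin n → X, ∑ y : Fin n → Y, if emp x ∈ Ω then (∏ i, P (x i, y i)) *
          ∑ ω : Fin M → (Fin n → U) × Fin K, iidWeight μ ω *
            (if ∀ j, ¬Admissible W N' x (ω j).1 then 1 else 0) else 0 := by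
          simp only [hA₁, Finset.mul_sum]
          rw [Finset.sum_comm]
          refine Finset.sum_congr rfl fun x _ => ?_
          rw [Finset.sum_comm]
          refine Finset.sum_congr rfl fun y _ => ?_
          by_cases hx : emp x ∈ Ω
          · simp only [hx, true_and, if_true]
            refine Finset.sum_congr rfl fun ω _ => ?_
            split_ifs <;> ring
          · simp [hx]
      _ ≤ ∑ x : Fin n → X, ∑ y : Fin n → Y, (∏ i, P (x i, y i)) * 2 ^ (-(n * L')) := by
          refine Finset.sum_le_sum fun x _ => Finset.sum_le_sum fun y _ => ?_
          split_ifs with hx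
          · exact mul_le_mul_of_nonneg_left (hmiss x hx) (hp0 x y)
          · exact mul_nonneg (hp0 x y) (by positivity)
      _ = _ := by
          simp only [← Finset.sum_mul]
          rw [sum_prod_pair_eq_one hP, one_mul]
  have hE₂ : ∀ ω, A₂ ω ≤ 2 ^ (n * δ) * 2 ^ (-(n * L')) := fun ω =>
    (sum_types_large_le hn hP.1 L' fun x => (ω (c ω x)).1).trans (by gcongr)
  -- The slack `13 δ`: `8 δ` from `M ^ 2`, `δ` from counting types, `2 δ` from the entropy of `U`,
  -- and `2 δ` from replacing `2 I` by `2 I_XU`.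
  have hE₃ : ∀ Q ∈ T₃, ∑ ω, iidWeight μ ω * A₃ Q ω ≤ 2 ^ (-(n * (L' - 13 * δ))) := by
    intro Q hQT
    obtain ⟨hQt, hQL, hQN⟩ := Finset.mem_filter.1 hQT
    have hQs : Q ∈ stdSimplex ℝ (X × Y × U) := by
      obtain ⟨z, -, rfl⟩ := Finset.mem_image.1 hQt
      exact emp_mem_stdSimplex hn z
    have hentU : ent (push (fun q => q.2.2) Q) < ent QU + δ := by
      have := hQN.2.2.1
      change ent (push Prod.snd (push pairXU Q)) < _ at this
      rwa [push_push] at this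
    have hinfo : chanInfo QX W - δ < infoXU Q := by
      have := hQN.2.2.2
      change _ < ent (push Prod.fst (push pairXU Q)) + ent (push Prod.snd (push pairXU Q)) -
        ent (push pairXU Q) at this
      rwa [push_push, push_push] at this
    refine (sum_competes_le hn hKpos hP.1 hg hgpos (η := ent QU - δ)
      (fun u hu => hgle n hn u hu) hQs).trans ?_
    have hMK : (M : ℝ) ^ 2 / K ≤ 2 ^ (n * (2 * chanInfo QX W + 8 * δ - R)) := by
      rw [div_le_iff₀ (by positivity)]
      calc (M : ℝ) ^ 2 ≤ (2 ^ (n * (chanInfo QX W + 4 * δ))) ^ 2 := by gcongr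
        _ = 2 ^ (n * (2 * chanInfo QX W + 8 * δ - R)) * 2 ^ (n * R) := by
          rw [← Real.rpow_mul_natCast two_pos.le, ← Real.rpow_add two_pos]
          congr 1
          push_cast
          ring
        _ ≤ _ := by gcongr
    calc _ ≤ (2 : ℝ) ^ (n * (2 * chanInfo QX W + 8 * δ - R)) * (2 ^ (n * δ) *
          2 ^ (n * (ent (push (fun q => q.2.2) Q) - (ent QU - δ) - divEnt P Q - infoXU Q -
            infoYU Q))) := by gcongr
      _ ≤ _ := by
          rw [← Real.rpow_add two_pos, ← Real.rpow_add two_pos, ← mul_add, ← mul_add, ← mul_neg]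
          refine Real.rpow_le_rpow_of_exponent_le one_le_two
            (mul_le_mul_of_nonneg_left ?_ hn0.le)
          linarith
  -- Two more `δ` complete the `15 δ`: one for the number of types in `T₃`, one for adding three
  -- terms.
  obtain ⟨ω, hω⟩ := exists_le_of_sum_mul_le hμM
    (F := fun ω => A₁ ω + A₂ ω + ∑ Q ∈ T₃, A₃ Q ω) (c := 2 ^ (-(n * L))) (by
      simp only [mul_add, Finset.sum_add_distrib]
      have h1 : ∑ ω, iidWeight μ ω * A₂ ω ≤ 2 ^ (n * δ) * 2 ^ (-(n * L')) := by
        refine (Finset.sum_le_sum fun ω _ => mul_le_mul_of_nonneg_left (hE₂ ω)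
          (hμM.1 ω)).trans ?_
        rw [← Finset.sum_mul, hμM.2, one_mul]
      have h2 : ∑ ω, iidWeight μ ω * ∑ Q ∈ T₃, A₃ Q ω ≤
          2 ^ (n * δ) * 2 ^ (-(n * (L' - 13 * δ))) := by
        calc _ = ∑ Q ∈ T₃, ∑ ω, iidWeight μ ω * A₃ Q ω := by
              simp only [Finset.mul_sum]
              rw [Finset.sum_comm]
          _ ≤ ∑ _Q ∈ T₃, (2 : ℝ) ^ (-(n * (L' - 13 * δ))) := Finset.sum_le_sum hE₃
          _ ≤ _ := by
              rw [Finset.sum_const, nsmul_eq_mul]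
              refine mul_le_mul_of_nonneg_right (le_trans ?_ hpolyQ) (by positivity)
              exact_mod_cast (Finset.card_filter_le _ _).trans (card_types_le n)
      rw [← Real.rpow_add two_pos] at h1 h2
      have hmono : ∀ a : ℝ, a ≤ -(n * (L' - 14 * δ)) → (2 : ℝ) ^ a ≤ 2 ^ (-(n * (L' - 14 * δ))) :=
        fun a ha => Real.rpow_le_rpow_of_exponent_le one_le_two ha
      have hnδ : 0 < n * δ := by positivity
      have e1 := hmono (-(n * L')) (by nlinarith)
      have e2 := hmono (n * δ + -(n * L')) (by nlinarith)
      have e3 := hmono (n * δ + -(n * (L' - 13 * δ))) (by nlinarith)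
      calc _ ≤ 3 * (2 : ℝ) ^ (-(n * (L' - 14 * δ))) := by linarith
        _ ≤ 2 ^ (n * δ) * 2 ^ (-(n * (L' - 14 * δ))) := by gcongr
        _ ≤ _ := by
          rw [← Real.rpow_add two_pos]
          refine Real.rpow_le_rpow_of_exponent_le one_le_two ?_
          nlinarith)
  exact ⟨K, f ω, gd ω, hKle, (hptw ω).trans hω⟩

end Binning

/-! ### Gluing local codes and passing to the exponent -/

section Assembly

open scoped Classical

set_option linter.unusedSectionVars false

variable {X Y Z : Type*} [Fintype X] [Fintype Y]

theorem HasRegionCode.mono {P : X × Y → ℝ} {d : X → Z → ℝ} {Δ r r' L : ℝ} {Ω : Set (X → ℝ)} {n : ℕ}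
    (h : HasRegionCode P d Δ r L Ω n) (hr : r ≤ r') : HasRegionCode P d Δ r' L Ω n := by
  obtain ⟨k, f, g, hk, he⟩ := h
  exact ⟨k, f, g, hk.trans (Real.rpow_le_rpow_of_exponent_le one_le_two
    (mul_le_mul_of_nonneg_left hr n.cast_nonneg)), he⟩

theorem nonempty_of_stdSimplex {A : Type*} [Fintype A] {Q : A → ℝ} (hQ : Q ∈ stdSimplex ℝ A) :
    Nonempty A := by
  by_contra h
  rw [not_nonempty_iff] at h
  have := hQ.2
  simp at this

/-- Near each source type the single-letter bound is achievable. -/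
theorem exists_region_code [Fintype Z] [Nonempty Z] {P : X × Y → ℝ}
    (hP : P ∈ stdSimplex ℝ (X × Y)) {d : X → Z → ℝ} {R Δ L L₀ ε : ℝ} (hR : 0 ≤ R)
    (hL : (L : EReal) < infSup fun W φ Q => eta R Δ P d W φ Q) (hL₀ : L₀ < L) (hε : 0 < ε)
    {QX : X → ℝ} (hQX : QX ∈ stdSimplex ℝ X) :
    ∃ Ω ∈ 𝓝 QX, ∀ᶠ n : ℕ in Filter.atTop, HasRegionCode P d Δ (R + ε) L₀ Ω n := by
  have h1 := hL.trans_le (iInf₂_le QX hQX)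
  obtain ⟨m, h2⟩ := lt_iSup_iff.1 h1
  obtain ⟨W, h3⟩ := lt_iSup_iff.1 h2
  obtain ⟨hW, h4⟩ := lt_iSup_iff.1 h3
  have h5 : ∀ QY ∈ stdSimplex ℝ Y, ∃ φ : Y → Fin m → Z, ∀ Q ∈ couplings QX W QY,
      (L : EReal) < eta R Δ P d W φ Q := by
    intro QY hQY
    obtain ⟨φ, hφ⟩ := lt_iSup_iff.1 (h4.trans_le (iInf₂_le QY hQY))
    exact ⟨φ, fun Q hQ => hφ.trans_le (iInf₂_le Q hQ)⟩
  obtain ⟨x⟩ := nonempty_of_stdSimplex hQX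
  have : Nonempty (Fin m) := nonempty_of_stdSimplex (hW x)
  obtain ⟨N, hN, hφ⟩ := exists_nhds_reproduction hW h5
  -- Both constructions lose at most `8 δ` in rate and `15 δ` in exponent.
  set δ := min (ε / 8) ((L - L₀) / 15) with hδdef
  have hδ : 0 < δ := lt_min (by positivity) (by linarith)
  have hδ1 : δ ≤ ε / 8 := min_le_left _ _
  have hδ2 : δ ≤ (L - L₀) / 15 := min_le_right _ _
  by_cases hκ : R ≤ kappa₂ P QX W
  · obtain ⟨Ω, hΩ, hev⟩ := exists_binning_code hP hκ hR hδ (L := L₀) (by linarith) hQX hW hN hφ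
    exact ⟨Ω, hΩ, hev.mono fun n hn => hn.mono (by linarith)⟩
  · obtain ⟨Ω, hΩ, hev⟩ := exists_zeroError_code hP hR hδ (L := L₀) (by linarith) hQX hW
      (not_le.1 hκ).le hN hφ
    exact ⟨Ω, hΩ, hev.mono fun n hn => hn.mono (by linarith)⟩

theorem minErrorProb_le {P : X × Y → ℝ} {d : X → Z → ℝ} {Δ r e : ℝ} {n : ℕ} {M : Type*} [Fintype M]
    (hM : Real.logb 2 (Fintype.card M) ≤ n * r) (f : (Fin n → X) → M)
    (g : M → (Fin n → Y) → Fin n → Z) (he : errorProb P d Δ f g ≤ e) :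
    minErrorProb P d Δ r n ≤ ENNReal.ofReal e := by
  set E := Fintype.equivFin M
  have heq : errorProb P d Δ (fun x => E (f x)) (fun k => g (E.symm k)) = errorProb P d Δ f g := by
    simp only [errorProb, Equiv.symm_apply_apply]
  refine (iInf₂_le (Fintype.card M) hM).trans ((iInf₂_le (fun x => E (f x))
    fun k => g (E.symm k)).trans ?_)
  rw [heq]
  exact ENNReal.ofReal_le_ofReal he

/-- Finitely many regions cover the simplex of source types. The encoder also sends the index of a
region containing the type of its word; this constant factor is absorbed by `ε / 2` in the rate and
`L₀ - L₁` in the exponent. -/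
theorem eventually_minErrorProb_le [Fintype Z] [Nonempty Z] {P : X × Y → ℝ}
    (hP : P ∈ stdSimplex ℝ (X × Y)) {d : X → Z → ℝ} {R Δ L L₁ ε : ℝ} (hR : 0 ≤ R)
    (hL : (L : EReal) < infSup fun W φ Q => eta R Δ P d W φ Q) (hL₁ : L₁ < L) (hε : 0 < ε) :
    ∀ᶠ n : ℕ in Filter.atTop,
      minErrorProb P d Δ (R + ε) n ≤ ENNReal.ofReal (2 ^ (-(n * L₁))) := by
  set L₀ := (L₁ + L) / 2 with hL₀
  have hreg : ∀ QX : X → ℝ, ∃ Ω ∈ 𝓝 QX, QX ∈ stdSimplex ℝ X →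
      ∀ᶠ n : ℕ in Filter.atTop, HasRegionCode P d Δ (R + ε / 2) L₀ Ω n := by
    intro QX
    by_cases hQX : QX ∈ stdSimplex ℝ X
    · obtain ⟨Ω, hΩ, hev⟩ := exists_region_code hP hR hL (L₀ := L₀) (by rw [hL₀]; linarith)
        (half_pos hε) hQX
      exact ⟨Ω, hΩ, fun _ => hev⟩
    · exact ⟨Set.univ, Filter.univ_mem, fun h => absurd h hQX⟩
  choose Ω hΩ hev using hreg
  obtain ⟨t, hts, hcov⟩ := (isCompact_stdSimplex ℝ X).elim_nhds_subcover Ω fun QX _ => hΩ QX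
  have hall : ∀ᶠ n : ℕ in Filter.atTop, ∀ QX ∈ t, HasRegionCode P d Δ (R + ε / 2) L₀ (Ω QX) n :=
    (Filter.eventually_all_finset t).2 fun QX hQX => hev QX (hts QX hQX)
  filter_upwards [hall, eventually_const_le_two_rpow t.card (half_pos hε),
    eventually_const_le_two_rpow t.card (by rw [hL₀]; linarith : 0 < L₀ - L₁),
    Filter.eventually_gt_atTop 0] with n hn hc1 hc2 hn0
  choose k f g hk he using fun QX : t => hn QX.1 QX.2
  have hcx : ∀ x : Fin n → X, ∃ QX : t, emp x ∈ Ω QX := by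
    intro x
    obtain ⟨QX, hQX, hx⟩ := Set.mem_iUnion₂.1 (hcov (emp_mem_stdSimplex hn0 x))
    exact ⟨⟨QX, hQX⟩, hx⟩
  choose c hc using hcx
  have hp0 : ∀ (x : Fin n → X) (y : Fin n → Y), 0 ≤ ∏ i, P (x i, y i) := fun x y =>
    Finset.prod_nonneg fun i _ => hP.1 _
  refine minErrorProb_le (M := Σ QX : t, Fin (k QX)) ?_ (fun x => ⟨c x, f (c x) x⟩)
    (fun p => g p.1 p.2) ?_
  · have hcard : (Fintype.card (Σ QX : t, Fin (k QX)) : ℝ) ≤ 2 ^ (n * (R + ε)) := by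
      rw [Fintype.card_sigma]
      push_cast
      calc _ ≤ ∑ _QX : t, (2 : ℝ) ^ (n * (R + ε / 2)) := by
            refine Finset.sum_le_sum fun QX _ => ?_
            rw [Fintype.card_fin]
            exact hk QX
        _ = t.card * (2 : ℝ) ^ (n * (R + ε / 2)) := by simp
        _ ≤ 2 ^ (n * (ε / 2)) * 2 ^ (n * (R + ε / 2)) := by gcongr
        _ = _ := by
          rw [← Real.rpow_add two_pos]
          congr 1
          ring
    rcases Nat.eq_zero_or_pos (Fintype.card (Σ QX : t, Fin (k QX))) with h0 | h0
    -- With an empty message set the logarithm is zero by convention, and the rate constraint still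
    -- holds.
    · rw [h0, Nat.cast_zero, Real.logb_zero]
      positivity
    · rwa [Real.logb_le_iff_le_rpow one_lt_two (by exact_mod_cast h0)]
  · calc errorProb P d Δ (fun x => (⟨c x, f (c x) x⟩ : Σ QX : t, Fin (k QX))) (fun p => g p.1 p.2)
        ≤ ∑ x : Fin n → X, ∑ y : Fin n → Y, ∑ QX : t, (if emp x ∈ Ω QX ∧
          Δ < (∑ i, d (x i) (g QX (f QX x) y i)) / n then ∏ i, P (x i, y i) else 0) := by
          refine Finset.sum_le_sum fun x _ => Finset.sum_le_sum fun y _ => ?_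
          have hnn : ∀ QX : t, 0 ≤ if emp x ∈ Ω QX ∧
              Δ < (∑ i, d (x i) (g QX (f QX x) y i)) / n then ∏ i, P (x i, y i) else 0 :=
            fun QX => by
              split_ifs
              exacts [hp0 x y, le_rfl]
          split_ifs with herr
          · have h1 := Finset.single_le_sum (fun QX _ => hnn QX) (Finset.mem_univ (c x))
            rwa [if_pos ⟨hc x, herr⟩] at h1
          · exact Finset.sum_nonneg fun QX _ => hnn QX
      _ = ∑ QX : t, ∑ x : Fin n → X, ∑ y : Fin n → Y, (if emp x ∈ Ω QX ∧
          Δ < (∑ i, d (x i) (g QX (f QX x) y i)) / n then ∏ i, P (x i, y i) else 0) := by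
          rw [Finset.sum_congr rfl fun x _ => Finset.sum_comm]
          exact Finset.sum_comm
      _ ≤ ∑ _QX : t, (2 : ℝ) ^ (-(n * L₀)) := Finset.sum_le_sum fun QX _ => he QX
      _ = t.card * (2 : ℝ) ^ (-(n * L₀)) := by simp
      _ ≤ 2 ^ (n * (L₀ - L₁)) * 2 ^ (-(n * L₀)) := by gcongr
      _ = _ := by
          rw [← Real.rpow_add two_pos]
          congr 1
          ring

theorem le_exponentAtRate [Fintype Z] [Nonempty Z] {P : X × Y → ℝ}
    (hP : P ∈ stdSimplex ℝ (X × Y)) {d : X → Z → ℝ} {R Δ L L₁ ε : ℝ} (hR : 0 ≤ R)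
    (hL : (L : EReal) < infSup fun W φ Q => eta R Δ P d W φ Q) (hL₁ : L₁ < L) (hε : 0 < ε) :
    (L₁ : EReal) ≤ exponentAtRate P d Δ (R + ε) := by
  refine Filter.le_liminf_of_le (by isBoundedDefault) ?_
  filter_upwards [eventually_minErrorProb_le hP hR hL hL₁ hε, Filter.eventually_gt_atTop 0]
    with n hn hn0
  have hpos : 0 < n * Real.log 2 := mul_pos (by exact_mod_cast hn0) (Real.log_pos one_lt_two)
  have h1 := ENNReal.log_monotone hn
  rw [ENNReal.log_ofReal_of_pos (by positivity), Real.log_rpow two_pos] at h1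
  rw [EReal.le_div_iff_mul_le (by exact_mod_cast hpos) (EReal.coe_ne_top _), EReal.le_neg]
  refine h1.trans (le_of_eq ?_)
  norm_cast
  ring

/-- Any real number strictly below the single-letter bound is achieved at rate `R + ε` for every `ε
> 0`, hence also in the limit. -/
theorem infSup_eta_le_errorExponent [Fintype Z] [Nonempty Z] {P : X × Y → ℝ}
    (hP : P ∈ stdSimplex ℝ (X × Y)) (d : X → Z → ℝ) {R : ℝ} (Δ : ℝ) (hR : 0 ≤ R) :
    infSup (fun W φ Q => eta R Δ P d W φ Q) ≤ errorExponent R Δ P d := by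
  refine EReal.ge_of_forall_gt_iff_ge.1 fun z hz => ?_
  obtain ⟨L, hzL, hL⟩ := EReal.lt_iff_exists_real_btwn.1 hz
  refine ge_of_tendsto (tendsto_errorExponent R Δ P d) ?_
  filter_upwards [self_mem_nhdsWithin] with ε hε
  exact le_exponentAtRate hP hR hL (by exact_mod_cast hzL) hε

end Assembly

end

end WynerZiv

theorem mainTheorem3 {X Y Z : Type*} [Fintype X] [Fintype Y] [Fintype Z] [Nonempty Z]
    (P : X × Y → ℝ) (hP : P ∈ stdSimplex ℝ (X × Y)) (d : X → Z → ℝ)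
    (R Δ : ℝ) (hR : 0 < R) (hΔ : 0 < Δ) :
    WynerZiv.infSup (fun W φ Q => WynerZiv.eta R Δ P d W φ Q) ≤
        WynerZiv.errorExponent R Δ P d ∧
      WynerZiv.infSup (fun W φ Q => WynerZiv.etaD R Δ P d W φ Q) ≤
        WynerZiv.infSup (fun W φ Q => WynerZiv.eta R Δ P d W φ Q) ∧
      ∀ (m : ℕ) (QX : X → ℝ) (W : X → Fin m → ℝ) (QY : Y → ℝ) (φ : Y → Fin m → Z)
        (Q : X × Y × Fin m → ℝ), QX ∈ stdSimplex ℝ X → WynerZiv.IsChannel W →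
        Q ∈ WynerZiv.couplings QX W QY →
          WynerZiv.etaD R Δ P d W φ Q ≤ WynerZiv.eta R Δ P d W φ Q :=
  ⟨WynerZiv.infSup_eta_le_errorExponent hP d Δ hR.le, WynerZiv.infSup_etaD_le P d R Δ,
    fun _ _ _ _ φ _ hQX hW hQ => WynerZiv.etaD_le_eta hQX hW hQ φ⟩
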